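/- Let $k_x,k_y,\mathrm{Ra},A,\gamma>0$, $H\ge 0$ and $\mathrm{Da},\zeta\in\mathbb{R}$. Let $\Omega=[0,2\pi/k_x]\times[0,2\pi/k_y]\times[0,1]$, with points $\mathbf{x}=(x,y,z)$, and let $T_b(z)=\mathrm{Ra}\,z$. For $t>0$ let $\mathbf{u}(\cdot,t)=(u,v,w)$, $\pi(\cdot,t)$, $\theta(\cdot,t)$, $\phi(\cdot,t)$ be real fields on the layer $\mathbb{R}^2\times[0,1]$ that are periodic in $x$ and $y$ with periods $2\pi/k_x$ and $2\pi/k_y$ and of class $W^{2,2}$ on the periodicity cell $\Omega$ (with weak derivatives taken in the whole layer, and continuous representatives). Assume that they satisfy, almost everywhere in space for every $t>0$, $$\mathbf{u}=-\nabla\pi-\mathrm{Ra}(\zeta-z)\theta\,\mathbf{k}+\tfrac{\theta^2}{2}\mathbf{k}+\mathrm{Da}\,\Delta\mathbf{u},\qquad \nabla\cdot\mathbf{u}=0,$$ $$\frac{\partial\theta}{\partial t}+\mathbf{u}\cdot\nabla\theta+\mathrm{Ra}\,w=\Delta\theta+H(\phi-\theta),\qquad A\frac{\partial\phi}{\partial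 t}=\Delta\phi-H\gamma(\phi-\theta),$$ where $\mathbf{k}=(0,0,1)$ and $\partial\theta/\partial t$, $\partial\phi/\partial t$ are derivatives of curves in $L^2(\Omega)$, together with the boundary conditions $u_z=v_z=w=\phi=\theta=0$ at $z=0,1$ (those for $u_z,v_z$ in the sense of traces) and the initial conditions $\theta(\cdot,0)=\theta_0$, $\phi(\cdot,0)=\phi_0$, attained in $L^2(\Omega)$ as $t\to0^+$. Suppose $\theta_0,\phi_0\in W^{2,2}(\Omega)\cap L^\infty(\Omega)$. Put $$\bar\theta_0=\operatorname*{ess\,sup}_{\Omega}\,(\theta_0+T_b-\mathrm{Ra})_+,\qquad \bar\phi_0=c\,\operatorname*{ess\,sup}_{\Omega}\,(\phi_0+T_b-\mathrm{Ra})_+,$$ $$\Gamma=\begin{cases}\bar\theta_0 & \text{if }\phi_0\le\mathrm{Ra}-T_b(z)\text{ a.e. in }\Omega,\\ \bar\theta_0+\bar\phi_0&\text{otherwise.}\end{cases}$$ Then for $c=1$ and also for $c=A/\gamma$: $\Gamma\ge 0$; $\theta_0(\mathbf{x})+T_b(z)-\mathrm{Ra}\le\Gamma$ for almost every $\mathbf{x}\in\Omega$;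 and $$\theta(\mathbf{x},t)+T_b(z)-\mathrm{Ra}\le\Gamma\qquad\text{for all }t>0\text{ and all }\mathbf{x}\in\Omega.$$ -/

import Mathlib

open MeasureTheory Filter Topology
open scoped ContDiff ENNReal

/-- Points `x = (x 0, x 1, x 2) = (x, y, z)` of three-dimensional space. -/
abbrev Space : Type := Fin 3 → ℝ

namespace Penetrative

/-- The periodicity cell `Ω = [0, 2π/kx] × [0, 2π/ky] × [0, 1]`. -/
def cell (kx ky : ℝ) : Set Space :=
  {x | x 0 ∈ Set.Icc 0 (2 * Real.pi / kx) ∧ x 1 ∈ Set.Icc 0 (2 * Real.pi / ky) ∧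
    x 2 ∈ Set.Icc (0 : ℝ) 1}

/-- Lebesgue measure on the periodicity cell. -/
noncomputable def cellMeasure (kx ky : ℝ) : Measure Space :=
  volume.restrict (cell kx ky)

/-- The open layer `0 < z < 1`. -/
def layer : Set Space := {x | x 2 ∈ Set.Ioo (0 : ℝ) 1}

/-- The closed layer `0 ≤ z ≤ 1`. -/
def closedLayer : Set Space := {x | x 2 ∈ Set.Icc (0 : ℝ) 1}

/-- The partial derivative `∂ψ/∂xᵢ` of a smooth function. -/
noncomputable def pderiv (i : Fin 3) (ψ : Space → ℝ) (x : Space) : ℝ :=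
  fderiv ℝ ψ x (Pi.single i 1)

/-- `g'` is the weak partial derivative `∂g/∂xᵢ` of `g` on the open set `U`. -/
def HasWeakDeriv (U : Set Space) (i : Fin 3) (g g' : Space → ℝ) : Prop :=
  LocallyIntegrableOn g U ∧ LocallyIntegrableOn g' U ∧
    ∀ ψ : Space → ℝ, ContDiff ℝ ∞ ψ → HasCompactSupport ψ → tsupport ψ ⊆ U →
      ∫ x in U, g x * pderiv i ψ x = -∫ x in U, g' x * ψ x

/-- The Sobolev space `W^{2,2}(U)`. -/
def MemW22 (U : Set Space) (g : Space → ℝ) : Prop :=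
  MemLp g 2 (volume.restrict U) ∧
    ∃ (grad : Fin 3 → Space → ℝ) (hess : Fin 3 → Fin 3 → Space → ℝ),
      (∀ i, MemLp (grad i) 2 (volume.restrict U) ∧ HasWeakDeriv U i g (grad i)) ∧
      (∀ i j, MemLp (hess i j) 2 (volume.restrict U) ∧ HasWeakDeriv U j (grad i) (hess i j))

/-- `g` is periodic in `x` with period `2π/kx` and in `y` with period `2π/ky`. -/
def HorizontallyPeriodic (kx ky : ℝ) (g : Space → ℝ) : Prop :=
  Function.Periodic g (Pi.single 0 (2 * Real.pi / kx)) ∧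
    Function.Periodic g (Pi.single 1 (2 * Real.pi / ky))

/-- A scalar field on the layer that is periodic in `x` and `y` and of class `W^{2,2}` on the
periodicity cell, together with its weak derivatives of first and second order.  Weak derivatives
are tested on the whole layer, so that they do not jump across the lateral faces of the cell.
In dimension three `W^{2,2}` functions are continuous up to the boundary after a change on a null
set; `val` is this representative.  Values outside the closed layer have no meaning. -/
structure PeriodicW22 (kx ky : ℝ) where
  val : Space → ℝ
  grad : Fin 3 → Space → ℝ
  hess : Fin 3 → Fin 3 → Space → ℝ
  continuousOn_val : ContinuousOn val closedLayer
  periodic_val : HorizontallyPeriodic kx ky val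
  periodic_grad : ∀ i, HorizontallyPeriodic kx ky (grad i)
  periodic_hess : ∀ i j, HorizontallyPeriodic kx ky (hess i j)
  memLp_grad : ∀ i, MemLp (grad i) 2 (cellMeasure kx ky)
  memLp_hess : ∀ i j, MemLp (hess i j) 2 (cellMeasure kx ky)
  weakDeriv_val : ∀ i, HasWeakDeriv layer i val (grad i)
  weakDeriv_grad : ∀ i j, HasWeakDeriv layer j (grad i) (hess i j)

/-- The Laplacian of a `W^{2,2}` field. -/
noncomputable def PeriodicW22.lap {kx ky : ℝ} (g : PeriodicW22 kx ky) (x : Space) : ℝ :=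
  ∑ j, g.hess j j x

/-- `g`, with weak vertical derivative `gz`, has zero trace on the planes `z = 0` and `z = 1`.
By the Gauss-Green formula the integral below is `∫_{z=1} g ψ - ∫_{z=0} g ψ`, and the test
functions are not required to vanish at the planes. -/
def HasZeroTrace (g gz : Space → ℝ) : Prop :=
  ∀ ψ : Space → ℝ, ContDiff ℝ ∞ ψ → HasCompactSupport ψ →
    ∫ x in layer, (g x * pderiv 2 ψ x + gz x * ψ x) = 0

/-- `g'` is the derivative at time `t` of the curve `s ↦ g s` in `L²(Ω)`. -/
def HasL2TimeDeriv (kx ky : ℝ) (g : ℝ → Space → ℝ) (g' : Space → ℝ) (t : ℝ) : Prop :=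
  MemLp g' 2 (cellMeasure kx ky) ∧
    Tendsto (fun h : ℝ => eLpNorm (fun x => (g (t + h) x - g t x) / h - g' x) 2
      (cellMeasure kx ky)) (𝓝[≠] 0) (𝓝 0)

/-- The curve `s ↦ g s`, `s > 0`, attains the initial value `g₀` in `L²(Ω)`. -/
def AttainsInitial (kx ky : ℝ) (g : ℝ → Space → ℝ) (g₀ : Space → ℝ) : Prop :=
  Tendsto (fun t : ℝ => eLpNorm (fun x => g t x - g₀ x) 2 (cellMeasure kx ky)) (𝓝[>] 0) (𝓝 0)

/-- `(u, p, θ, φ)` (perturbations of velocity, pressure, fluid temperature and solid temperature)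
solves for `t > 0` the system
`u = -∇p - Ra (ζ - z) θ k + (θ²/2) k + Da Δu`, `div u = 0`,
`∂θ/∂t + u·∇θ + Ra w = Δθ + H (φ - θ)`, `A ∂φ/∂t = Δφ - H γ (φ - θ)`, with `u = (u, v, w)`, with
the stress-free boundary conditions `u_z = v_z = w = φ = θ = 0` at `z = 0, 1`, and with initial
temperatures `θ₀`, `φ₀`.  Values at times `t ≤ 0` have no meaning. -/
structure IsPerturbation {kx ky : ℝ} (Ra Da ζ H A γ : ℝ) (u : ℝ → Fin 3 → PeriodicW22 kx ky)
    (p θ φ : ℝ → PeriodicW22 kx ky) (θ₀ φ₀ : Space → ℝ) : Prop where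
  momentum : ∀ t > 0, ∀ i, ∀ᵐ x ∂(cellMeasure kx ky),
    (u t i).val x = -(p t).grad i x
      + (if i = 2 then -(Ra * (ζ - x 2) * (θ t).val x) + (θ t).val x ^ 2 / 2 else 0)
      + Da * (u t i).lap x
  incompressible : ∀ t > 0, ∀ᵐ x ∂(cellMeasure kx ky), ∑ i, (u t i).grad i x = 0
  fluid_energy : ∀ t > 0, ∃ θ' : Space → ℝ,
    HasL2TimeDeriv kx ky (fun s => (θ s).val) θ' t ∧
      ∀ᵐ x ∂(cellMeasure kx ky),
        θ' x + ∑ i, (u t i).val x * (θ t).grad i x + Ra * (u t 2).val x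
          = (θ t).lap x + H * ((φ t).val x - (θ t).val x)
  solid_energy : ∀ t > 0, ∃ φ' : Space → ℝ,
    HasL2TimeDeriv kx ky (fun s => (φ s).val) φ' t ∧
      ∀ᵐ x ∂(cellMeasure kx ky),
        A * φ' x = (φ t).lap x - H * γ * ((φ t).val x - (θ t).val x)
  boundary : ∀ t > 0, ∀ x : Space, x 2 = 0 ∨ x 2 = 1 →
    (u t 2).val x = 0 ∧ (θ t).val x = 0 ∧ (φ t).val x = 0
  stress_free : ∀ t > 0, ∀ i : Fin 3, i ≠ 2 → HasZeroTrace ((u t i).grad 2) ((u t i).hess 2 2)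
  initial_fluid : AttainsInitial kx ky (fun s => (θ s).val) θ₀
  initial_solid : AttainsInitial kx ky (fun s => (φ s).val) φ₀

/-- The conduction temperature `T_b(z) = Ra z`. -/
def Tb (Ra z : ℝ) : ℝ := Ra * z

/-- `ess sup_Ω (g + T_b - Ra)₊`. -/
noncomputable def excess (kx ky Ra : ℝ) (g : Space → ℝ) : ℝ :=
  essSup (fun x => max (g x + Tb Ra (x 2) - Ra) 0) (cellMeasure kx ky)

open Classical in
/-- The bound `Γ`: `θ̄₀` if `φ₀ ≤ Ra - T_b` almost everywhere in `Ω`, and `θ̄₀ + φ̄₀` otherwise, with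
`θ̄₀ = ess sup_Ω (θ₀ + T_b - Ra)₊` and `φ̄₀ = c · ess sup_Ω (φ₀ + T_b - Ra)₊`. -/
noncomputable def Gam (kx ky Ra c : ℝ) (θ₀ φ₀ : Space → ℝ) : ℝ :=
  if ∀ᵐ x ∂(cellMeasure kx ky), φ₀ x ≤ Ra - Tb Ra (x 2) then excess kx ky Ra θ₀
  else excess kx ky Ra θ₀ + c * excess kx ky Ra φ₀

end Penetrative

namespace Penetrative

/-! The bound is a comparison principle. Let `(M, N)` be a spatially constant solution of the heat
exchange, `M' = H (N - M)`, `A N' = -H γ (N - M)`, with both components positive, and put `S = θ +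
Ra z - Ra - M`, `T = φ + Ra z - Ra - N`. The affine profile absorbs the source `Ra w` into the
transport term, and `S`, `T` are strictly negative on the planes `z = 0, 1`. The energy `γ ‖S₊‖² / 2
+ A ‖T₊‖² / 2` does not increase: diffusion dissipates it, solenoidal transport preserves it, and
the exchange terms contribute `-H γ (S - T)(S₊ - T₊) ≤ 0`. If `M` and `N` start above the initial
excesses, the energy tends to `0` as `t → 0⁺`, so it vanishes for all time and `S ≤ 0`
(`energy_dissipation`, `IsPerturbation.fluid_le`).

The linear system for `(M, N)` is solved explicitly, and `M t = (1 - s) M₀ + s N₀` with `0 ≤ s ≤ A /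
(γ + A)`. Since `A / (γ + A)` is at most `1` and at most `A / γ`, both values of `c` are admissible
(`IsPerturbation.fluid_le_of_initial`).

The integrations by parts avoid any Sobolev calculus for `g₊`. As `g` is negative near the planes,
`g₊` is a continuous, periodic function supported inside the layer, and the correlation `h ↦ ∫ g(x)
g₊(x - h eᵢ)` is twice differentiable at `0`, both derivatives falling on `g`. Convexity of `s₊² /
2` and translation invariance make `h = 0` a local maximum. The sign of the second derivative gives
`∫ ∂ᵢᵢg g₊ ≤ 0`; the vanishing of the first controls the error in the chain rule `∫ v ∂ᵢg g₊ = -∫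
∂ᵢv g₊² / 2`. -/

/-- The unit vector in the direction of the `i`-th coordinate. -/
abbrev basisVec (i : Fin 3) : Space := Pi.single i 1

/-! ### Differentiating `∫ f(x) η(x - h eᵢ)` in `h` for weakly differentiable `f`. -/

section Translate

variable {U K : Set Space} {i : Fin 3} {f f' η : Space → ℝ} {r : ℝ}

theorem integrable_mul_of_support_subset (hK : IsCompact K) (hf : IntegrableOn f K)
    (hη : Continuous η) (hs : Function.support η ⊆ K) : Integrable fun x => f x * η x := by
  have h : IntegrableOn (fun x => f x * η x) K := hf.mul_continuousOn hη.continuousOn hK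
  refine (integrableOn_iff_integrable_of_support_subset fun x hx => hs ?_).1 h
  exact fun h0 => hx (by simp [h0])

theorem abs_integral_mul_sub_le {η' : Space → ℝ} (hK : IsCompact K) (hf : IntegrableOn f K)
    (hη : Continuous η) (hs : Function.support η ⊆ K) (hη' : Continuous η')
    (hs' : Function.support η' ⊆ K) {c : ℝ} (hc : ∀ x, |η x - η' x| ≤ c) :
    |(∫ x, f x * η x) - ∫ x, f x * η' x| ≤ c * ∫ x in K, |f x| := by
  have hi := integrable_mul_of_support_subset hK hf hη hs
  have hi' := integrable_mul_of_support_subset hK hf hη' hs'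
  rw [← integral_sub hi hi']
  have h0 : ∀ x, x ∉ K → f x * η x - f x * η' x = 0 := by
    intro x hx
    have h1 : η x = 0 := by by_contra h; exact hx (hs h)
    have h2 : η' x = 0 := by by_contra h; exact hx (hs' h)
    simp [h1, h2]
  rw [← setIntegral_eq_integral_of_forall_compl_eq_zero h0, ← integral_const_mul,
    ← Real.norm_eq_abs]
  refine norm_integral_le_of_norm_le (hf.abs.const_mul c) (Eventually.of_forall fun x => ?_)
  rw [← mul_sub, Real.norm_eq_abs, abs_mul, mul_comm]
  exact mul_le_mul_of_nonneg_right (hc x) (abs_nonneg _)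

/-- A single compact set serves all small translates, so local integrability of `f` supplies uniform
bounds. -/
theorem exists_isCompact_translates (hc : HasCompactSupport η)
    (hU : ∀ x ∈ tsupport η, ∀ s ∈ Set.Icc (-r) r, x + s • basisVec i ∈ U) :
    ∃ K, IsCompact K ∧ K ⊆ U ∧
      ∀ s ∈ Set.Icc (-r) r, ∀ x, x - s • basisVec i ∈ tsupport η → x ∈ K := by
  refine ⟨(fun q : Space × ℝ => q.1 + q.2 • basisVec i) '' (tsupport η ×ˢ Set.Icc (-r) r),
    (hc.isCompact.prod isCompact_Icc).image (by fun_prop), ?_, ?_⟩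
  · rintro _ ⟨q, hq, rfl⟩
    exact hU _ hq.1 _ hq.2
  · intro s hs x hx
    exact ⟨(x - s • basisVec i, s), ⟨hx, hs⟩, by simp⟩

theorem continuous_pderiv (hη : ContDiff ℝ ∞ η) : Continuous (pderiv i η) :=
  (hη.continuous_fderiv (by simp)).clm_apply continuous_const

theorem support_pderiv_subset : Function.support (pderiv i η) ⊆ tsupport η := by
  intro x hx
  refine support_fderiv_subset ℝ (f := η) fun h0 => hx ?_
  simp [pderiv, h0]

theorem hasDerivAt_translate (hη : ContDiff ℝ ∞ η) (x : Space) (s : ℝ) :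
    HasDerivAt (fun s : ℝ => η (x - s • basisVec i)) (-pderiv i η (x - s • basisVec i)) s := by
  have h1 : HasDerivAt (fun s : ℝ => x - s • basisVec i) (-basisVec i) s := by
    simpa using ((hasDerivAt_id s).smul_const (basisVec i)).const_sub x
  have h2 := (hη.differentiable (by simp) (x - s • basisVec i)).hasFDerivAt.comp_hasDerivAt s h1
  simpa only [map_neg] using! h2

/-- Differentiation under the integral sign produces `-∂ᵢη` at the translated point; the definition
of the weak derivative, tested with the translate of `η`, moves it onto `f`. -/
theorem HasWeakDeriv.hasDerivAt_integral_of_contDiff (hf : HasWeakDeriv U i f f')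
    (hη : ContDiff ℝ ∞ η) (hc : HasCompactSupport η)
    (hU : ∀ x ∈ tsupport η, ∀ s ∈ Set.Icc (-r) r, x + s • basisVec i ∈ U) {h : ℝ}
    (hh : h ∈ Set.Ioo (-r) r) :
    HasDerivAt (fun h : ℝ => ∫ x, f x * η (x - h • basisVec i))
      (∫ x, f' x * η (x - h • basisVec i)) h := by
  obtain ⟨K, hK, hKU, hηK⟩ := exists_isCompact_translates hc hU
  have hh' := Set.Ioo_subset_Icc_self hh
  have hfK : IntegrableOn f K := hf.1.integrableOn_compact_subset hKU hK
  have hpc : Continuous (pderiv i η) := continuous_pderiv hη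
  have hps : Function.support (pderiv i η) ⊆ tsupport η := support_pderiv_subset
  have hpcs : HasCompactSupport (pderiv i η) := hc.mono' hps
  obtain ⟨C, hC⟩ := hpcs.exists_bound_of_continuous hpc
  have hsupp : ∀ s ∈ Set.Icc (-r) r,
      Function.support (fun x => η (x - s • basisVec i)) ⊆ K :=
    fun s hs x hx => hηK s hs x (subset_tsupport _ hx)
  have hcont : ∀ s : ℝ, Continuous fun x => η (x - s • basisVec i) := fun s =>
    hη.continuous.comp (by fun_prop)
  have hmain := (hasDerivAt_integral_of_dominated_loc_of_deriv_le (μ := volume)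
    (F := fun (h : ℝ) x => f x * η (x - h • basisVec i))
    (F' := fun (h : ℝ) x => f x * -pderiv i η (x - h • basisVec i))
    (bound := K.indicator fun x => |f x| * C) (Ioo_mem_nhds hh.1 hh.2)
    (by
      filter_upwards [Ioo_mem_nhds hh.1 hh.2] with s hs
      exact (integrable_mul_of_support_subset hK hfK (hcont s)
        (hsupp s (Set.Ioo_subset_Icc_self hs))).aestronglyMeasurable)
    (integrable_mul_of_support_subset hK hfK (hcont h) (hsupp h hh'))
    (by
      refine (integrable_mul_of_support_subset hK hfK
        (η := fun x => -pderiv i η (x - h • basisVec i))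
        ((hpc.comp (by fun_prop)).neg) fun x hx => ?_).aestronglyMeasurable
      refine hηK h hh' x (hps fun h0 => hx ?_)
      simp [h0])
    (by
      refine Eventually.of_forall fun x s hs => ?_
      by_cases hx : x ∈ K
      · rw [Set.indicator_of_mem hx, norm_mul, norm_neg]
        exact mul_le_mul_of_nonneg_left (hC _) (norm_nonneg _)
      · rw [Set.indicator_of_notMem hx]
        have : pderiv i η (x - s • basisVec i) = 0 := by
          by_contra h0
          exact hx (hηK s (Set.Ioo_subset_Icc_self hs) x (hps h0))
        simp [this])
    ((integrable_indicator_iff hK.measurableSet).2 (hfK.abs.mul_const C))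
    (Eventually.of_forall fun x s _ => (hasDerivAt_translate hη x s).const_mul (f x))).2
  suffices hd : ∫ x, f' x * η (x - h • basisVec i)
      = ∫ x, f x * -pderiv i η (x - h • basisVec i) by
    rw [hd]; exact hmain
  set ψ : Space → ℝ := fun x => η (x - h • basisVec i) with hψ
  have hts : tsupport ψ ⊆ K := closure_minimal (hsupp h hh') hK.isClosed
  have hpψ : ∀ x, pderiv i ψ x = pderiv i η (x - h • basisVec i) := by
    intro x
    simp only [pderiv, hψ]
    rw [fderiv_comp_sub]
  have hw := hf.2.2 ψ (hη.comp (by fun_prop)) (HasCompactSupport.of_support_subset_isCompact hK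
    (hsupp h hh')) (hts.trans hKU)
  rw [setIntegral_eq_integral_of_forall_compl_eq_zero,
    setIntegral_eq_integral_of_forall_compl_eq_zero] at hw
  · simp_rw [hpψ] at hw
    simp only [mul_neg, integral_neg]
    linarith
  · intro x hx
    have : ψ x = 0 := by
      by_contra h0
      exact hx (hKU (hts (subset_tsupport _ h0)))
    simp [this]
  · intro x hx
    have : pderiv i ψ x = 0 := by
      rw [hpψ]
      by_contra h0
      exact hx (hKU (hηK h hh' x (hps h0)))
    simp [this]

/-- Smooth functions supported in the support of `η` approximate it uniformly, so the integrals
converge and their derivatives converge uniformly in `h`. Mere continuity of `η` matters because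
positive parts are not smooth. -/
theorem HasWeakDeriv.hasDerivAt_integral_translate (hf : HasWeakDeriv U i f f')
    (hη : Continuous η) (hc : HasCompactSupport η)
    (hU : ∀ x ∈ tsupport η, ∀ s ∈ Set.Icc (-r) r, x + s • basisVec i ∈ U) {h : ℝ}
    (hh : h ∈ Set.Ioo (-r) r) :
    HasDerivAt (fun h : ℝ => ∫ x, f x * η (x - h • basisVec i))
      (∫ x, f' x * η (x - h • basisVec i)) h := by
  obtain ⟨K, hK, hKU, hηK⟩ := exists_isCompact_translates hc hU
  have hfK : IntegrableOn f K := hf.1.integrableOn_compact_subset hKU hK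
  have hfK' : IntegrableOn f' K := hf.2.1.integrableOn_compact_subset hKU hK
  choose ηn hsm hdist hsupp using fun n : ℕ =>
    hη.exists_contDiff_approx (⊤ : ℕ∞) (ε := fun _ => 1 / ((n : ℝ) + 1)) continuous_const
      (fun _ => by positivity)
  have hts : ∀ n, tsupport (ηn n) ⊆ tsupport η := fun n => closure_mono (hsupp n)
  have hbound : ∀ g : Space → ℝ, IntegrableOn g K → ∀ s ∈ Set.Ioo (-r) r, ∀ n,
      |(∫ x, g x * η (x - s • basisVec i)) - ∫ x, g x * ηn n (x - s • basisVec i)|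
        ≤ 1 / ((n : ℝ) + 1) * ∫ x in K, |g x| := by
    intro g hg s hs n
    refine abs_integral_mul_sub_le hK hg (hη.comp (by fun_prop)) ?_
      ((hsm n).continuous.comp (by fun_prop)) ?_ fun x => ?_
    · exact fun x hx => hηK s (Set.Ioo_subset_Icc_self hs) x (subset_tsupport _ hx)
    · exact fun x hx => hηK s (Set.Ioo_subset_Icc_self hs) x (hts n (subset_tsupport _ hx))
    · have := (hdist n (x - s • basisVec i)).le
      rwa [dist_comm, Real.dist_eq] at this
  have hlim : ∀ g : Space → ℝ,
      Tendsto (fun n : ℕ => 1 / ((n : ℝ) + 1) * ∫ x in K, |g x|) atTop (𝓝 0) := fun g => by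
    simpa using tendsto_one_div_add_atTop_nhds_zero_nat.mul_const (∫ x in K, |g x|)
  refine hasDerivAt_of_tendstoUniformlyOn (l := atTop) isOpen_Ioo
    (f := fun n (h : ℝ) => ∫ x, f x * ηn n (x - h • basisVec i))
    (f' := fun n (h : ℝ) => ∫ x, f' x * ηn n (x - h • basisVec i))
    (g' := fun (h : ℝ) => ∫ x, f' x * η (x - h • basisVec i)) ?_ ?_ ?_ hh
  · rw [Metric.tendstoUniformlyOn_iff]
    intro ε hε
    filter_upwards [(hlim f').eventually_lt_const hε] with n hn s hs
    exact (hbound f' hfK' s hs n).trans_lt hn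
  · refine Eventually.of_forall fun n s hs => ?_
    exact hf.hasDerivAt_integral_of_contDiff (hsm n) (hc.mono (hsupp n))
      (fun x hx => hU x (hts n hx)) hs
  · intro s hs
    rw [tendsto_iff_dist_tendsto_zero]
    refine squeeze_zero (fun _ => dist_nonneg) (fun n => ?_) (hlim f)
    rw [dist_comm]
    exact hbound f hfK s hs n

end Translate

/-! ### Periodic functions in one direction: translation invariance and the tent weight. -/

section Slab

variable {i : Fin 3} {a : ℝ} {F : Space → ℝ}

/-- The set of points whose `i`-th coordinate lies in `(s, t]`. -/
def slab (i : Fin 3) (s t : ℝ) : Set Space := {x | x i ∈ Set.Ioc s t}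

theorem measurableSet_slab (i : Fin 3) (s t : ℝ) : MeasurableSet (slab i s t) :=
  measurableSet_Ioc.preimage (measurable_pi_apply i)

theorem isAddFundamentalDomain_slab (i : Fin 3) (ha : 0 < a) (t : ℝ) :
    IsAddFundamentalDomain (AddSubgroup.zmultiples (a • basisVec i)) (slab i t (t + a))
      (volume : Measure Space) := by
  refine IsAddFundamentalDomain.mk' (measurableSet_slab i t _).nullMeasurableSet fun x => ?_
  have hinj : Function.Injective fun n : ℤ => n • (a • basisVec i) := by
    intro m n hmn
    have := congrFun hmn i
    simpa [ha.ne'] using this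
  have hb : Function.Bijective (Set.codRestrict (fun n : ℤ => n • (a • basisVec i))
      (AddSubgroup.zmultiples (a • basisVec i) : Set Space) fun n => ⟨n, rfl⟩) :=
    (Equiv.ofInjective _ hinj).bijective
  refine hb.existsUnique_iff.2 ?_
  have := existsUnique_add_zsmul_mem_Ioc ha (x i) t
  simpa [slab, AddSubgroup.vadd_def, add_comm, mul_comm] using! this

theorem setIntegral_add_right (v : Space) (s : Set Space) (F : Space → ℝ) :
    ∫ x in (· + v) ⁻¹' s, F (x + v) = ∫ x in s, F x :=
  (measurePreserving_add_right volume v).setIntegral_preimage_emb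
    (measurableEmbedding_addRight v) F s

theorem periodic_zmultiples (hF : Function.Periodic F (a • basisVec i))
    (g : AddSubgroup.zmultiples (a • basisVec i)) (x : Space) : F (g +ᵥ x) = F x := by
  obtain ⟨_, n, rfl⟩ := g
  simpa [AddSubgroup.vadd_def, add_comm] using hF.zsmul n x

/-- A slab of width `a` and its translate are both fundamental domains for the group of periods. -/
theorem setIntegral_slab_add (ha : 0 < a) (hF : Function.Periodic F (a • basisVec i)) (h : ℝ) :
    ∫ x in slab i 0 a, F (x + h • basisVec i) = ∫ x in slab i 0 a, F x := by
  have h1 := setIntegral_add_right (h • basisVec i) (slab i h (h + a)) F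
  have h2 : (· + h • basisVec i) ⁻¹' slab i h (h + a) = slab i 0 a := by
    ext x
    simp only [slab, Set.mem_preimage, Set.mem_ofPred_eq, Set.mem_Ioc, Pi.add_apply, Pi.smul_apply,
      Pi.single_eq_same, smul_eq_mul, mul_one]
    constructor <;> rintro ⟨h1, h2⟩ <;> constructor <;> linarith
  rw [h2] at h1
  rw [h1]
  simpa using (isAddFundamentalDomain_slab i ha h).setIntegral_eq
    (isAddFundamentalDomain_slab i ha 0) (periodic_zmultiples hF)

/-- The tent function on `[-1, 1]`; its integer translates add up to one. -/
def tent (s : ℝ) : ℝ := max 0 (1 - |s|)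

theorem continuous_tent : Continuous tent := by unfold tent; fun_prop

theorem tent_eq_zero {s : ℝ} (hs : 1 ≤ |s|) : tent s = 0 := max_eq_left (by linarith)

theorem tent_add_tent {s : ℝ} (h0 : 0 ≤ s) (h1 : s ≤ 1) : tent (s - 1) + tent s = 1 := by
  unfold tent
  rw [abs_of_nonneg h0, abs_of_nonpos (by linarith), max_eq_right (by linarith),
    max_eq_right (by linarith)]
  ring

/-- Cut the support of the tent at `0` and shift the left half by one period: the two weights then
add up to one. -/
theorem setIntegral_slab_eq_integral_tent (ha : 0 < a)
    (hF : Function.Periodic F (a • basisVec i)) (hint : IntegrableOn F (slab i (-a) a)) :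
    ∫ x in slab i 0 a, F x = ∫ x, tent (x i / a) * F x := by
  have hc : Continuous fun x : Space => tent (x i / a) := continuous_tent.comp (by fun_prop)
  have hint' : IntegrableOn (fun x => tent (x i / a) * F x) (slab i (-a) a) := by
    refine Integrable.bdd_mul (c := 1) hint hc.aestronglyMeasurable
      (Eventually.of_forall fun x => ?_)
    unfold tent
    rw [Real.norm_eq_abs, abs_of_nonneg (le_max_left _ _)]
    exact max_le zero_le_one (by linarith [abs_nonneg (x i / a)])
  have h0 : ∀ x ∉ slab i (-a) a, tent (x i / a) * F x = 0 := by
    intro x hx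
    rw [tent_eq_zero, zero_mul]
    by_contra! hlt
    rw [abs_lt, lt_div_iff₀ ha, div_lt_iff₀ ha] at hlt
    exact hx ⟨by linarith, by linarith⟩
  have hsplit : slab i (-a) a = slab i (-a) 0 ∪ slab i 0 a := by
    ext x
    simp only [slab, Set.mem_ofPred_eq, Set.mem_union, ← Set.Ioc_union_Ioc_eq_Ioc
      (neg_nonpos.2 ha.le) ha.le]
  have hdisj : Disjoint (slab i (-a) 0) (slab i 0 a) :=
    Set.disjoint_left.2 fun x h1 h2 => by linarith [h1.2, h2.1]
  have hl : IntegrableOn (fun x => tent (x i / a) * F x) (slab i (-a) 0) :=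
    hint'.mono_set (hsplit ▸ Set.subset_union_left)
  have hr : IntegrableOn (fun x => tent (x i / a) * F x) (slab i 0 a) :=
    hint'.mono_set (hsplit ▸ Set.subset_union_right)
  have hpre : (· + (-a) • basisVec i) ⁻¹' slab i (-a) 0 = slab i 0 a := by
    ext x
    simp [slab]
  have hshift : ∀ x : Space, F (x + (-a) • basisVec i) = F x := fun x => by
    rw [← hF (x + (-a) • basisVec i)]; congr 1; module
  have hl' : IntegrableOn (fun x => tent (x i / a - 1) * F x) (slab i 0 a) := by
    have := ((measurePreserving_add_right volume ((-a) • basisVec i)).integrableOn_comp_preimage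
      (measurableEmbedding_addRight _)).2 hl
    rw [hpre] at this
    refine this.congr_fun (fun x _ => ?_) (measurableSet_slab i 0 a)
    simp only [Function.comp, hshift]
    congr 2
    simp
    field_simp
    ring
  rw [← setIntegral_eq_integral_of_forall_compl_eq_zero h0, hsplit,
    setIntegral_union hdisj (measurableSet_slab i 0 a) hl hr,
    ← setIntegral_add_right ((-a) • basisVec i) (slab i (-a) 0), hpre]
  have hval : ∀ x : Space, (x + (-a) • basisVec i) i / a = x i / a - 1 := fun x => by
    simp
    field_simp
    ring
  simp only [hval, hshift]
  rw [← integral_add hl' hr]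
  refine setIntegral_congr_fun (measurableSet_slab i 0 a) fun x hx => ?_
  rw [← add_mul, tent_add_tent (div_nonneg hx.1.le ha.le) ((div_le_one ha).2 hx.2), one_mul]

end Slab

/-! ### Integrals of horizontally periodic functions over the cell. -/

section Cell

variable {kx ky : ℝ} {i : Fin 3} {F G : Space → ℝ}

theorem HorizontallyPeriodic.mul (hF : HorizontallyPeriodic kx ky F)
    (hG : HorizontallyPeriodic kx ky G) : HorizontallyPeriodic kx ky fun x => F x * G x :=
  ⟨hF.1.mul hG.1, hF.2.mul hG.2⟩

theorem HorizontallyPeriodic.comp_add (hF : HorizontallyPeriodic kx ky F) (v : Space) :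
    HorizontallyPeriodic kx ky fun x => F (x + v) :=
  ⟨fun x => by simpa only [add_right_comm] using hF.1 (x + v),
    fun x => by simpa only [add_right_comm] using hF.2 (x + v)⟩

theorem HorizontallyPeriodic.comp_sub (hF : HorizontallyPeriodic kx ky F) (v : Space) :
    HorizontallyPeriodic kx ky fun x => F (x - v) := by
  simpa only [sub_eq_add_neg] using hF.comp_add (-v)

theorem HorizontallyPeriodic.periodic_zero (hF : HorizontallyPeriodic kx ky F) :
    Function.Periodic F ((2 * Real.pi / kx) • basisVec 0) := by
  simpa [basisVec, ← Pi.single_smul] using hF.1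

theorem HorizontallyPeriodic.periodic_one (hF : HorizontallyPeriodic kx ky F) :
    Function.Periodic F ((2 * Real.pi / ky) • basisVec 1) := by
  simpa [basisVec, ← Pi.single_smul] using hF.2

theorem cell_eq_Icc (kx ky : ℝ) :
    cell kx ky = Set.Icc 0 ![2 * Real.pi / kx, 2 * Real.pi / ky, 1] := by
  ext x
  simp only [cell, Set.mem_ofPred_eq, Set.mem_Icc, Pi.le_def, Fin.forall_fin_succ]
  simp
  tauto

theorem isCompact_cell (kx ky : ℝ) : IsCompact (cell kx ky) := cell_eq_Icc kx ky ▸ isCompact_Icc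

theorem measurableSet_cell (kx ky : ℝ) : MeasurableSet (cell kx ky) :=
  (isCompact_cell kx ky).measurableSet

theorem cell_subset_closedLayer (kx ky : ℝ) : cell kx ky ⊆ closedLayer := fun _ hx => hx.2.2

theorem layer_subset_closedLayer : layer ⊆ closedLayer := fun _ hx => Set.Ioo_subset_Icc_self hx

theorem setIntegral_cell_eq_slab (hF : ∀ x, F x ≠ 0 → x ∈ layer) :
    ∫ x in cell kx ky, F x
      = ∫ x in slab 0 0 (2 * Real.pi / kx) ∩ slab 1 0 (2 * Real.pi / ky), F x := by
  have h1 := Measure.univ_pi_Ioc_ae_eq_Icc (μ := fun _ : Fin 3 => (volume : Measure ℝ))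
    (f := 0) (g := ![2 * Real.pi / kx, 2 * Real.pi / ky, 1])
  rw [← volume_pi, ← cell_eq_Icc] at h1
  rw [← setIntegral_congr_set h1]
  symm
  refine setIntegral_eq_of_subset_of_forall_sdiff_eq_zero
    ((measurableSet_slab _ _ _).inter (measurableSet_slab _ _ _)) ?_ ?_
  · intro x hx
    simp only [Set.mem_univ_pi] at hx
    exact ⟨hx 0, hx 1⟩
  · rintro x ⟨hx, hx'⟩
    by_contra h0
    have h2 := hF x h0
    refine hx' (Set.mem_univ_pi.2 fun j => ?_)
    fin_cases j
    · exact hx.1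
    · exact hx.2
    · exact Set.Ioo_subset_Ioc_self h2

theorem setIntegral_inter_eq_indicator {s t : Set Space} (ht : MeasurableSet t) :
    ∫ x in s ∩ t, F x = ∫ x in s, t.indicator F x := (setIntegral_indicator ht).symm

theorem periodic_indicator_slab {j : Fin 3} (hij : i ≠ j) {a s t : ℝ}
    (hF : Function.Periodic F (a • basisVec i)) :
    Function.Periodic ((slab j s t).indicator F) (a • basisVec i) := by
  intro x
  have : x + a • basisVec i ∈ slab j s t ↔ x ∈ slab j s t := by simp [slab, hij.symm]
  by_cases hx : x ∈ slab j s t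
  · rw [Set.indicator_of_mem hx, Set.indicator_of_mem (this.2 hx), hF]
  · rw [Set.indicator_of_notMem hx, Set.indicator_of_notMem (mt this.1 hx)]

/-- Translation invariance of the integral of a periodic function over the cell. -/
theorem HorizontallyPeriodic.setIntegral_cell_add (hkx : 0 < kx) (hky : 0 < ky)
    (hF : HorizontallyPeriodic kx ky F) (i : Fin 3) (h : ℝ) (h0 : ∀ x, F x ≠ 0 → x ∈ layer)
    (h1 : ∀ x, F (x + h • basisVec i) ≠ 0 → x ∈ layer) :
    ∫ x in cell kx ky, F (x + h • basisVec i) = ∫ x in cell kx ky, F x := by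
  rw [setIntegral_cell_eq_slab h0, setIntegral_cell_eq_slab h1]
  have hmem : ∀ (j : Fin 3) (s t : ℝ), i ≠ j → ∀ x : Space,
      x + h • basisVec i ∈ slab j s t ↔ x ∈ slab j s t := by
    intro j s t hij x
    simp [slab, hij.symm]
  have hind : ∀ (j : Fin 3) (s t : ℝ), i ≠ j → ∀ x : Space,
      (slab j s t).indicator (fun y => F (y + h • basisVec i)) x
        = (slab j s t).indicator F (x + h • basisVec i) := by
    intro j s t hij x
    by_cases hx : x ∈ slab j s t
    · rw [Set.indicator_of_mem hx, Set.indicator_of_mem ((hmem j s t hij x).2 hx)]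
    · rw [Set.indicator_of_notMem hx, Set.indicator_of_notMem (mt (hmem j s t hij x).1 hx)]
  have hax : 0 < 2 * Real.pi / kx := by positivity
  have hay : 0 < 2 * Real.pi / ky := by positivity
  fin_cases i
  · simp only [setIntegral_inter_eq_indicator (measurableSet_slab 1 _ _)]
    rw [← setIntegral_slab_add hax (periodic_indicator_slab (by decide) hF.periodic_zero) h]
    exact integral_congr_ae (Eventually.of_forall fun x => hind 1 _ _ (by decide) x)
  · rw [Set.inter_comm]
    simp only [setIntegral_inter_eq_indicator (measurableSet_slab 0 _ _)]
    rw [← setIntegral_slab_add hay (periodic_indicator_slab (by decide) hF.periodic_one) h]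
    exact integral_congr_ae (Eventually.of_forall fun x => hind 0 _ _ (by decide) x)
  · rw [← setIntegral_add_right (h • basisVec 2) _ F]
    congr 2
    ext x
    exact (and_congr (hmem 0 _ _ (by decide) x) (hmem 1 _ _ (by decide) x)).symm

/-- A continuous weight whose horizontal translates by the periods add up to one. -/
noncomputable def horizontalTent (kx ky : ℝ) (x : Space) : ℝ :=
  tent (x 0 / (2 * Real.pi / kx)) * tent (x 1 / (2 * Real.pi / ky))

theorem continuous_horizontalTent (kx ky : ℝ) : Continuous (horizontalTent kx ky) :=
  (continuous_tent.comp (by fun_prop)).mul (continuous_tent.comp (by fun_prop))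

/-- The part of `δ ≤ z ≤ 1 - δ` above the support of `horizontalTent`. -/
def box (kx ky δ : ℝ) : Set Space :=
  Set.Icc ![-(2 * Real.pi / kx), -(2 * Real.pi / ky), δ]
    ![2 * Real.pi / kx, 2 * Real.pi / ky, 1 - δ]

theorem mem_box {δ : ℝ} {x : Space} : x ∈ box kx ky δ ↔
    x 0 ∈ Set.Icc (-(2 * Real.pi / kx)) (2 * Real.pi / kx) ∧
    x 1 ∈ Set.Icc (-(2 * Real.pi / ky)) (2 * Real.pi / ky) ∧ x 2 ∈ Set.Icc δ (1 - δ) := by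
  simp only [box, Set.mem_Icc, Pi.le_def, Fin.forall_fin_succ]
  simp
  tauto

theorem mem_box_of_horizontalTent_ne_zero (hkx : 0 < kx) (hky : 0 < ky) {δ : ℝ} {x : Space}
    (hx : horizontalTent kx ky x ≠ 0) (hz : x 2 ∈ Set.Icc δ (1 - δ)) : x ∈ box kx ky δ := by
  have hax : 0 < 2 * Real.pi / kx := by positivity
  have hay : 0 < 2 * Real.pi / ky := by positivity
  have key : ∀ {s a : ℝ}, 0 < a → tent (s / a) ≠ 0 → s ∈ Set.Icc (-a) a := by
    intro s a ha hs
    have := lt_of_not_ge (mt tent_eq_zero hs)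
    rw [abs_lt, lt_div_iff₀ ha, div_lt_iff₀ ha] at this
    constructor <;> linarith
  exact mem_box.2 ⟨key hax (left_ne_zero_of_mul hx), key hay (right_ne_zero_of_mul hx), hz⟩

/-- The tent identity is applied in `x` and then in `y`. The weight makes a periodic integrand
compactly supported, as the test functions of the weak derivatives have to be. -/
theorem HorizontallyPeriodic.setIntegral_cell_eq_integral (hkx : 0 < kx) (hky : 0 < ky)
    (hF : HorizontallyPeriodic kx ky F) {δ : ℝ} (hδ : 0 < δ)
    (h0 : ∀ x, F x ≠ 0 → x 2 ∈ Set.Icc δ (1 - δ)) (hint : IntegrableOn F (box kx ky δ)) :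
    ∫ x in cell kx ky, F x = ∫ x, horizontalTent kx ky x * F x := by
  have hax : 0 < 2 * Real.pi / kx := by positivity
  have hay : 0 < 2 * Real.pi / ky := by positivity
  have hl : ∀ x, F x ≠ 0 → x ∈ layer := fun x hx =>
    ⟨by linarith [(h0 x hx).1], by linarith [(h0 x hx).2]⟩
  have hbm : MeasurableSet (box kx ky δ) := measurableSet_Icc
  have hint0 : IntegrableOn ((slab 1 0 (2 * Real.pi / ky)).indicator F)
      (slab 0 (-(2 * Real.pi / kx)) (2 * Real.pi / kx)) := by
    refine IntegrableOn.of_forall_sdiff_eq_zero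
      (hint.indicator (measurableSet_slab 1 _ _)) (measurableSet_slab 0 _ _) ?_
    rintro x ⟨hx, hxb⟩
    by_contra hne
    have hx1 := Set.mem_of_indicator_ne_zero hne
    rw [Set.indicator_of_mem hx1] at hne
    exact hxb (mem_box.2 ⟨Set.Ioc_subset_Icc_self hx,
      ⟨by linarith [hx1.1], hx1.2⟩, h0 x hne⟩)
  have hper1 : Function.Periodic (fun x : Space => tent (x 0 / (2 * Real.pi / kx)) * F x)
      ((2 * Real.pi / ky) • basisVec 1) := by
    intro x
    simp only [hF.periodic_one x]
    simp
  have hint1 : IntegrableOn (fun x : Space => tent (x 0 / (2 * Real.pi / kx)) * F x)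
      (slab 1 (-(2 * Real.pi / ky)) (2 * Real.pi / ky)) := by
    refine IntegrableOn.of_forall_sdiff_eq_zero
      (hint.continuousOn_mul (continuous_tent.comp (by fun_prop)).continuousOn isCompact_Icc)
      (measurableSet_slab 1 _ _) ?_
    rintro x ⟨hx, hxb⟩
    by_contra hne
    have h1 : tent (x 0 / (2 * Real.pi / kx)) ≠ 0 := left_ne_zero_of_mul hne
    have h2 := lt_of_not_ge (mt tent_eq_zero h1)
    rw [abs_lt, lt_div_iff₀ hax, div_lt_iff₀ hax] at h2
    exact hxb (mem_box.2 ⟨⟨by linarith, by linarith⟩, Set.Ioc_subset_Icc_self hx,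
      h0 x (right_ne_zero_of_mul hne)⟩)
  rw [setIntegral_cell_eq_slab hl, setIntegral_inter_eq_indicator (measurableSet_slab 1 _ _),
    setIntegral_slab_eq_integral_tent hax
      (periodic_indicator_slab (by decide) hF.periodic_zero) hint0]
  have : ∀ x : Space, tent (x 0 / (2 * Real.pi / kx)) *
      (slab 1 0 (2 * Real.pi / ky)).indicator F x
      = (slab 1 0 (2 * Real.pi / ky)).indicator
        (fun y => tent (y 0 / (2 * Real.pi / kx)) * F y) x := by
    intro x
    rw [Set.indicator_mul_right]
  simp only [this]
  rw [integral_indicator (measurableSet_slab 1 _ _),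
    setIntegral_slab_eq_integral_tent hay hper1 hint1]
  refine integral_congr_ae (Eventually.of_forall fun x => ?_)
  simp only [horizontalTent]
  ring

end Cell

/-! ### Differentiation under translation over the cell. -/

/-- `η` vanishes outside the slab `δ ≤ z ≤ 1 - δ`. -/
def VerticalSupport (δ : ℝ) (η : Space → ℝ) : Prop :=
  ∀ x, η x ≠ 0 → x 2 ∈ Set.Icc δ (1 - δ)

theorem isOpen_layer : IsOpen layer := isOpen_Ioo.preimage (continuous_apply 2)

theorem add_smul_mem_layer {δ s : ℝ} (hs : |s| < δ) {x : Space} (hx : x 2 ∈ Set.Icc δ (1 - δ))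
    (i : Fin 3) : x + s • basisVec i ∈ layer := by
  have h1 := abs_lt.1 hs
  have h2 : (x + s • basisVec i) 2 = x 2 ∨ (x + s • basisVec i) 2 = x 2 + s := by
    fin_cases i <;> simp
  have h3 := abs_nonneg s
  have h4 := hx.1
  have h5 := hx.2
  rcases h2 with h2 | h2 <;> constructor <;> rw [h2] <;> linarith

theorem mem_layer_of_sub_smul {δ s : ℝ} (hs : |s| < δ) {x : Space} {i : Fin 3}
    (hx : (x - s • basisVec i) 2 ∈ Set.Icc δ (1 - δ)) : x ∈ layer := by
  simpa using add_smul_mem_layer hs hx i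

theorem mem_layer_of_Icc {δ : ℝ} (hδ : 0 < δ) {x : Space} (hx : x 2 ∈ Set.Icc δ (1 - δ)) :
    x ∈ layer := ⟨by linarith [hx.1], by linarith [hx.2]⟩

section CellDerivative

variable {kx ky δ : ℝ} {i : Fin 3} {f f' g η : Space → ℝ}

theorem setIntegral_cell_translate (hkx : 0 < kx) (hky : 0 < ky)
    (hg : HorizontallyPeriodic kx ky g) (hp : HorizontallyPeriodic kx ky η)
    (h0 : VerticalSupport δ η) (i : Fin 3) {s : ℝ} (hs : |s| < δ) :
    ∫ x in cell kx ky, g x * η (x - s • basisVec i)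
      = ∫ x in cell kx ky, g (x + s • basisVec i) * η x := by
  have := (hg.mul (hp.comp_sub (s • basisVec i))).setIntegral_cell_add hkx hky i s
    (fun x hx => mem_layer_of_sub_smul hs (h0 _ (right_ne_zero_of_mul hx)))
    (fun x hx => by
      have h1 := h0 _ (right_ne_zero_of_mul hx)
      rw [add_sub_cancel_right] at h1
      exact mem_layer_of_Icc ((abs_nonneg s).trans_lt hs) h1)
  simpa using this.symm

/-- The translation is first moved onto `g`, so that the tent multiplies the untranslated `η`;
shifting back on the whole space translates the product of tent and `η` as one test function. -/
theorem setIntegral_cell_translate_eq_integral (hkx : 0 < kx) (hky : 0 < ky)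
    (hg : HorizontallyPeriodic kx ky g) (hgl : LocallyIntegrableOn g layer)
    (hη : Continuous η) (hp : HorizontallyPeriodic kx ky η) (h0 : VerticalSupport δ η)
    (i : Fin 3) {s : ℝ} (hs : |s| < δ) :
    ∫ x in cell kx ky, g x * η (x - s • basisVec i)
      = ∫ x, g x * (horizontalTent kx ky (x - s • basisVec i) * η (x - s • basisVec i)) := by
  have hδ : 0 < δ := (abs_nonneg s).trans_lt hs
  set v : Space := s • basisVec i with hv
  rw [setIntegral_cell_translate hkx hky hg hp h0 i hs]
  have hK : IsCompact ((· + v) '' box kx ky δ) :=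
    IsCompact.image isCompact_Icc (by fun_prop)
  have hKl : (· + v) '' box kx ky δ ⊆ layer := by
    rintro _ ⟨x, hx, rfl⟩
    exact add_smul_mem_layer hs (mem_box.1 hx).2.2 i
  have hint : IntegrableOn (fun x => g (x + v)) (box kx ky δ) :=
    ((measurePreserving_add_right volume v).integrableOn_image
      (measurableEmbedding_addRight v)).1 (hgl.integrableOn_compact_subset hKl hK)
  rw [((hg.comp_add v).mul hp).setIntegral_cell_eq_integral hkx hky hδ
      (fun x hx => h0 x (right_ne_zero_of_mul hx))
      (hint.mul_continuousOn hη.continuousOn isCompact_Icc),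
    ← integral_sub_right_eq_self _ v]
  refine integral_congr_ae (Eventually.of_forall fun x => ?_)
  simp only [sub_add_cancel]
  ring

/-- Differentiation under translation: the derivative falls on the weakly differentiable factor. -/
theorem HasWeakDeriv.hasDerivAt_setIntegral_cell (hkx : 0 < kx) (hky : 0 < ky)
    (hf : HasWeakDeriv layer i f f') (hfp : HorizontallyPeriodic kx ky f)
    (hfp' : HorizontallyPeriodic kx ky f') (hη : Continuous η)
    (hp : HorizontallyPeriodic kx ky η) (h0 : VerticalSupport δ η) {h : ℝ} (hh : |h| < δ) :
    HasDerivAt (fun h : ℝ => ∫ x in cell kx ky, f x * η (x - h • basisVec i))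
      (∫ x in cell kx ky, f' x * η (x - h • basisVec i)) h := by
  have hc : Continuous fun x => horizontalTent kx ky x * η x :=
    (continuous_horizontalTent kx ky).mul hη
  have hsub : Function.support (fun x => horizontalTent kx ky x * η x) ⊆ box kx ky δ :=
    fun x hx => mem_box_of_horizontalTent_ne_zero hkx hky (left_ne_zero_of_mul hx)
      (h0 x (right_ne_zero_of_mul hx))
  have hts : tsupport (fun x => horizontalTent kx ky x * η x) ⊆ box kx ky δ :=
    closure_minimal hsub isClosed_Icc
  obtain ⟨r, hr, hrδ⟩ := exists_between hh
  have hd := hf.hasDerivAt_integral_translate (r := r) hc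
    (HasCompactSupport.of_support_subset_isCompact isCompact_Icc hsub)
    (fun x hx s hs => add_smul_mem_layer ((abs_le.2 hs).trans_lt hrδ)
      (mem_box.1 (hts hx)).2.2 i) (abs_lt.1 hr)
  rw [setIntegral_cell_translate_eq_integral hkx hky hfp' hf.2.1 hη hp h0 i hh]
  refine hd.congr_of_eventuallyEq ?_
  filter_upwards [Ioo_mem_nhds (abs_lt.1 hh).1 (abs_lt.1 hh).2] with s hs
  exact setIntegral_cell_translate_eq_integral hkx hky hfp hf.1 hη hp h0 i (abs_lt.2 hs)

end CellDerivative

/-! ### Extension by zero of functions supported away from the planes. -/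

section Cut

variable {kx ky δ : ℝ} {v η g : Space → ℝ}

theorem VerticalSupport.tsupport_subset (h0 : VerticalSupport δ η) :
    tsupport η ⊆ {x | x 2 ∈ Set.Icc δ (1 - δ)} :=
  closure_minimal h0 (isClosed_Icc.preimage (continuous_apply 2))

/-- On the closed support of `η` a translation by less than `δ` stays in the layer, so only
meaningful values of `g` enter. -/
theorem continuous_mul_translate (hη : Continuous η) (h0 : VerticalSupport δ η)
    (hg : ContinuousOn g layer) (i : Fin 3) {s : ℝ} (hs : |s| < δ) :
    Continuous fun x => η x * g (x + s • basisVec i) := by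
  refine ContinuousOn.continuous_of_tsupport_subset (s := {x | x + s • basisVec i ∈ layer}) ?_
    (isOpen_layer.preimage (by fun_prop)) fun x hx => ?_
  · exact hη.continuousOn.mul (hg.comp (by fun_prop) fun x hx => hx)
  · exact add_smul_mem_layer hs (h0.tsupport_subset (closure_mono (fun y hy =>
      left_ne_zero_of_mul hy) hx)) i

theorem verticalSupport_indicator
    (h0 : ∀ x ∈ closedLayer, v x ≠ 0 → x 2 ∈ Set.Icc δ (1 - δ)) :
    VerticalSupport δ (layer.indicator v) := fun x hx => by
  have hm := Set.mem_of_indicator_ne_zero hx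
  rw [Set.indicator_of_mem hm] at hx
  exact h0 x (layer_subset_closedLayer hm) hx

theorem continuous_indicator_layer (hδ : 0 < δ) (hv : ContinuousOn v closedLayer)
    (h0 : ∀ x ∈ closedLayer, v x ≠ 0 → x 2 ∈ Set.Icc δ (1 - δ)) :
    Continuous (layer.indicator v) := by
  refine ContinuousOn.continuous_of_tsupport_subset (s := layer) ?_ isOpen_layer fun x hx =>
    mem_layer_of_Icc hδ ((verticalSupport_indicator h0).tsupport_subset hx)
  exact (hv.mono layer_subset_closedLayer).congr fun x hx => Set.indicator_of_mem hx v

theorem HorizontallyPeriodic.indicator_layer (hv : HorizontallyPeriodic kx ky v) :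
    HorizontallyPeriodic kx ky (layer.indicator v) := by
  have key : ∀ w : Space, w 2 = 0 → Function.Periodic v w →
      Function.Periodic (layer.indicator v) w := by
    intro w hw hv x
    have : x + w ∈ layer ↔ x ∈ layer := by simp [layer, hw]
    by_cases hx : x ∈ layer
    · rw [Set.indicator_of_mem hx, Set.indicator_of_mem (this.2 hx), hv]
    · rw [Set.indicator_of_notMem hx, Set.indicator_of_notMem (mt this.1 hx)]
  exact ⟨key _ (by simp) hv.1, key _ (by simp) hv.2⟩

theorem indicator_layer_eq_of_mem_closedLayer (hδ : 0 < δ)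
    (h0 : ∀ x ∈ closedLayer, v x ≠ 0 → x 2 ∈ Set.Icc δ (1 - δ)) {x : Space}
    (hx : x ∈ closedLayer) : layer.indicator v x = v x := by
  by_cases hv : v x = 0
  · by_cases hl : x ∈ layer
    · rw [Set.indicator_of_mem hl]
    · rw [Set.indicator_of_notMem hl, hv]
  · exact Set.indicator_of_mem (mem_layer_of_Icc hδ (h0 x hx hv)) v

end Cut

/-! ### Calculus at a local maximum. -/

section LocalMax

/-- A positive second derivative at a critical point would make it a local minimum as well, hence
`φ` locally constant and its second derivative zero. -/
theorem nonpos_of_isLocalMax {φ φ' : ℝ → ℝ} {x c : ℝ}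
    (h1 : ∀ᶠ h in 𝓝 x, HasDerivAt φ (φ' h) h) (h2 : HasDerivAt φ' c x)
    (hmax : IsLocalMax φ x) : c ≤ 0 := by
  by_contra! hc
  have hd : deriv φ =ᶠ[𝓝 x] φ' := h1.mono fun h hh => hh.deriv
  have hdd : deriv (deriv φ) x = c := by rw [hd.deriv_eq]; exact h2.deriv
  have hmin : IsLocalMin φ x := isLocalMin_of_deriv_deriv_pos (by rwa [hdd]) hmax.deriv_eq_zero
    h1.self_of_nhds.continuousAt
  have hconst : φ =ᶠ[𝓝 x] fun _ => φ x := by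
    filter_upwards [hmin, hmax] with h ha hb using le_antisymm hb ha
  have h3 : deriv φ =ᶠ[𝓝 x] fun _ => 0 := by
    filter_upwards [hconst.eventuallyEq_nhds] with h hh
    rw [hh.deriv_eq, deriv_const]
  rw [h3.deriv_eq, deriv_const] at hdd
  exact hc.ne hdd

theorem hasDerivAt_zero_of_abs_le {φ ψ : ℝ → ℝ} {x C : ℝ} (hψ : HasDerivAt ψ 0 x)
    (h : ∀ᶠ y in 𝓝 x, |φ y - φ x| ≤ C * |ψ y - ψ x|) : HasDerivAt φ 0 x := by
  rw [hasDerivAt_iff_isLittleO] at hψ ⊢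
  simp only [smul_zero, sub_zero] at hψ ⊢
  exact (Asymptotics.IsBigO.of_bound C h).trans_isLittleO hψ

end LocalMax

/-! ### Positive parts of fields that are negative on the planes. -/

section Truncation

variable {kx ky : ℝ}

theorem HorizontallyPeriodic.exists_mem_cell {v : Space → ℝ} (hkx : 0 < kx) (hky : 0 < ky)
    (hv : HorizontallyPeriodic kx ky v) {x : Space} (hx : x ∈ closedLayer) :
    ∃ y ∈ cell kx ky, v y = v x ∧ y 2 = x 2 := by
  have hax : 0 < 2 * Real.pi / kx := by positivity
  have hay : 0 < 2 * Real.pi / ky := by positivity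
  obtain ⟨m, hm, -⟩ := existsUnique_add_zsmul_mem_Ioc hax (x 0) 0
  obtain ⟨n, hn, -⟩ := existsUnique_add_zsmul_mem_Ioc hay (x 1) 0
  refine ⟨x + m • Pi.single 0 (2 * Real.pi / kx) + n • Pi.single 1 (2 * Real.pi / ky), ?_, ?_, ?_⟩
  · refine ⟨?_, ?_, ?_⟩
    · simpa using Set.Ioc_subset_Icc_self hm
    · simpa using Set.Ioc_subset_Icc_self hn
    · simpa [closedLayer] using hx
  · rw [hv.2.zsmul n, hv.1.zsmul m]
  · simp

/-- The set `v ≥ 0` in the cell is compact and misses both planes, so its distance to them is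
attained and positive; periodicity carries this to the whole layer. -/
theorem HorizontallyPeriodic.exists_pos_of_neg_boundary {v : Space → ℝ} (hkx : 0 < kx)
    (hky : 0 < ky) (hv : HorizontallyPeriodic kx ky v) (hc : ContinuousOn v closedLayer)
    (hb : ∀ x : Space, x 2 = 0 ∨ x 2 = 1 → v x < 0) :
    ∃ δ > 0, ∀ x ∈ closedLayer, 0 ≤ v x → x 2 ∈ Set.Icc δ (1 - δ) := by
  set S : Set Space := cell kx ky ∩ v ⁻¹' Set.Ici 0 with hS
  have hcl : IsClosed S := (hc.mono (cell_subset_closedLayer kx ky)).preimage_isClosed_of_isClosed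
    (isCompact_cell kx ky).isClosed isClosed_Ici
  have hcomp : IsCompact S := (isCompact_cell kx ky).of_isClosed_subset hcl Set.inter_subset_left
  rcases S.eq_empty_or_nonempty with he | hne
  · refine ⟨1, one_pos, fun x hx h0 => ?_⟩
    obtain ⟨y, hy, hvy, -⟩ := hv.exists_mem_cell hkx hky hx
    exact absurd (show y ∈ S from ⟨hy, by simpa [hvy] using h0⟩) (by simp [he])
  · obtain ⟨y, hy, hmin⟩ := hcomp.exists_isMinOn hne
      (f := fun x : Space => min (x 2) (1 - x 2)) (by fun_prop)
    have hyz := hy.1.2.2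
    have h0 : y 2 ≠ 0 := fun h => (hb y (Or.inl h)).not_ge hy.2
    have h1 : y 2 ≠ 1 := fun h => (hb y (Or.inr h)).not_ge hy.2
    refine ⟨min (y 2) (1 - y 2), lt_min (lt_of_le_of_ne hyz.1 h0.symm)
      (sub_pos.2 (lt_of_le_of_ne hyz.2 h1)), fun x hx hvx => ?_⟩
    obtain ⟨w, hw, hvw, hwz⟩ := hv.exists_mem_cell hkx hky hx
    have := hmin (show w ∈ S from ⟨hw, by simpa [hvw] using hvx⟩)
    simp only [Set.mem_ofPred_eq, hwz] at this
    exact ⟨this.trans (min_le_left _ _), by linarith [this.trans (min_le_right _ _)]⟩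

theorem posPart_mul_sub_le (a b : ℝ) :
    max a 0 * (b - a) ≤ max b 0 ^ 2 / 2 - max a 0 ^ 2 / 2 := by
  rcases le_total a 0 with ha | ha <;> rcases le_total b 0 with hb | hb <;>
    simp only [ha, hb, max_eq_left, max_eq_right] <;> nlinarith [sq_nonneg (a - b)]

variable (g : PeriodicW22 kx ky)

/-- The positive part of the field, extended by zero outside the layer. -/
noncomputable def PeriodicW22.pos : Space → ℝ := layer.indicator fun x => max (g.val x) 0

/-- Half the square of the positive part of the field, extended by zero outside the layer. -/
noncomputable def PeriodicW22.halfSq : Space → ℝ :=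
  layer.indicator fun x => max (g.val x) 0 ^ 2 / 2

variable {g} {δ : ℝ}

theorem PeriodicW22.continuousOn_cell : ContinuousOn g.val (cell kx ky) :=
  g.continuousOn_val.mono (cell_subset_closedLayer kx ky)

theorem HorizontallyPeriodic.comp {v : Space → ℝ} (hv : HorizontallyPeriodic kx ky v)
    (q : ℝ → ℝ) : HorizontallyPeriodic kx ky fun x => q (v x) :=
  ⟨fun x => congrArg q (hv.1 x), fun x => congrArg q (hv.2 x)⟩

theorem PeriodicW22.periodic_pos : HorizontallyPeriodic kx ky g.pos :=
  (g.periodic_val.comp fun s => max s 0).indicator_layer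

theorem PeriodicW22.periodic_halfSq : HorizontallyPeriodic kx ky g.halfSq :=
  (g.periodic_val.comp fun s => max s 0 ^ 2 / 2).indicator_layer

end Truncation

/-! ### Diffusion and transport tested against the positive part. -/

section Support

variable {kx ky δ : ℝ} {g : PeriodicW22 kx ky}

/-- The field is negative in the closed layer outside the slab `δ ≤ z ≤ 1 - δ`. -/
def PeriodicW22.NegNearBoundary (g : PeriodicW22 kx ky) (δ : ℝ) : Prop :=
  ∀ x ∈ closedLayer, 0 ≤ g.val x → x 2 ∈ Set.Icc δ (1 - δ)

theorem PeriodicW22.NegNearBoundary.max_ne_zero (hs : g.NegNearBoundary δ) (x : Space)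
    (hx : x ∈ closedLayer) (h : max (g.val x) 0 ≠ 0) : x 2 ∈ Set.Icc δ (1 - δ) := by
  refine hs x hx ?_
  by_contra! h0
  exact h (max_eq_right h0.le)

theorem PeriodicW22.NegNearBoundary.halfSq_ne_zero (hs : g.NegNearBoundary δ) (x : Space)
    (hx : x ∈ closedLayer) (h : max (g.val x) 0 ^ 2 / 2 ≠ 0) : x 2 ∈ Set.Icc δ (1 - δ) :=
  hs.max_ne_zero x hx fun h0 => h (by simp [h0])

theorem PeriodicW22.NegNearBoundary.continuous_pos (hs : g.NegNearBoundary δ) (hδ : 0 < δ) :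
    Continuous g.pos :=
  continuous_indicator_layer hδ (g.continuousOn_val.sup continuousOn_const) hs.max_ne_zero

theorem PeriodicW22.NegNearBoundary.continuous_halfSq (hs : g.NegNearBoundary δ) (hδ : 0 < δ) :
    Continuous g.halfSq :=
  continuous_indicator_layer hδ (((g.continuousOn_val.sup continuousOn_const).pow 2).div_const 2)
    hs.halfSq_ne_zero

theorem PeriodicW22.NegNearBoundary.verticalSupport_pos (hs : g.NegNearBoundary δ) :
    VerticalSupport δ g.pos := verticalSupport_indicator hs.max_ne_zero

theorem PeriodicW22.NegNearBoundary.verticalSupport_halfSq (hs : g.NegNearBoundary δ) :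
    VerticalSupport δ g.halfSq := verticalSupport_indicator hs.halfSq_ne_zero

theorem PeriodicW22.NegNearBoundary.pos_eq (hs : g.NegNearBoundary δ) (hδ : 0 < δ) {x : Space}
    (hx : x ∈ cell kx ky) : g.pos x = max (g.val x) 0 :=
  indicator_layer_eq_of_mem_closedLayer hδ hs.max_ne_zero hx.2.2

/-- Convexity of `s ↦ s₊² / 2`, for the field and its translate. -/
theorem PeriodicW22.NegNearBoundary.pos_mul_sub_le (hs : g.NegNearBoundary δ) (hδ : 0 < δ)
    (i : Fin 3) {h : ℝ} (hh : |h| < δ) (x : Space) :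
    g.pos x * (g.val (x + h • basisVec i) - g.val x)
      ≤ g.halfSq (x + h • basisVec i) - g.halfSq x := by
  by_cases h0 : g.pos x = 0
  -- Here the translated point may leave the layer, but only the nonnegativity of `g.halfSq` is
  -- needed.
  · have h1 : g.halfSq x = 0 := by
      by_cases hx : x ∈ layer
      · rw [pos, Set.indicator_of_mem hx] at h0
        rw [halfSq, Set.indicator_of_mem hx, h0]
        simp
      · exact Set.indicator_of_notMem hx _
    rw [h0, h1, zero_mul, sub_zero]
    exact Set.indicator_nonneg (fun _ _ => by positivity) _
  · have hz := hs.verticalSupport_pos x h0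
    rw [pos, halfSq, Set.indicator_of_mem (mem_layer_of_Icc hδ hz),
      Set.indicator_of_mem (mem_layer_of_Icc hδ hz),
      Set.indicator_of_mem (add_smul_mem_layer hh hz i)]
    exact posPart_mul_sub_le _ _

theorem PeriodicW22.NegNearBoundary.continuousOn_pos_mul (hs : g.NegNearBoundary δ) (hδ : 0 < δ)
    (i : Fin 3) {h : ℝ} (hh : |h| < δ) :
    ContinuousOn (fun x => g.pos x * (g.val (x + h • basisVec i) - g.val x)) (cell kx ky) := by
  have h1 := continuous_mul_translate (hs.continuous_pos hδ) hs.verticalSupport_pos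
    (g.continuousOn_val.mono layer_subset_closedLayer) i hh
  simp only [mul_sub]
  exact h1.continuousOn.sub ((hs.continuous_pos hδ).continuousOn.mul g.continuousOn_cell)

theorem PeriodicW22.NegNearBoundary.continuous_halfSq_sub (hs : g.NegNearBoundary δ)
    (hδ : 0 < δ) (i : Fin 3) (h : ℝ) :
    Continuous fun x => g.halfSq (x + h • basisVec i) - g.halfSq x :=
  ((hs.continuous_halfSq hδ).comp (by fun_prop)).sub (hs.continuous_halfSq hδ)

theorem PeriodicW22.NegNearBoundary.integral_halfSq_sub (hs : g.NegNearBoundary δ)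
    (hkx : 0 < kx) (hky : 0 < ky) (hδ : 0 < δ) (i : Fin 3) {h : ℝ} (hh : |h| < δ) :
    ∫ x in cell kx ky, (g.halfSq (x + h • basisVec i) - g.halfSq x) = 0 := by
  have hc := hs.continuous_halfSq hδ
  have hc' : Continuous fun x => g.halfSq (x + h • basisVec i) := hc.comp (by fun_prop)
  rw [integral_sub (hc'.continuousOn.integrableOn_compact (isCompact_cell kx ky))
    (hc.continuousOn.integrableOn_compact (isCompact_cell kx ky)), sub_eq_zero]
  refine g.periodic_halfSq.setIntegral_cell_add hkx hky i h
    (fun x hx => mem_layer_of_Icc hδ (hs.verticalSupport_halfSq x hx)) fun x hx => ?_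
  have h1 := hs.verticalSupport_halfSq _ hx
  rw [← sub_neg_eq_add, ← neg_smul] at h1
  exact mem_layer_of_sub_smul (by rwa [abs_neg]) h1

/-- The increment of a correlation of two fields, moved to the translated field. -/
theorem PeriodicW22.integral_translate_sub (hkx : 0 < kx) (hky : 0 < ky) {η : Space → ℝ}
    (hη : Continuous η) (hp : HorizontallyPeriodic kx ky η) (h0 : VerticalSupport δ η)
    (i : Fin 3) {h : ℝ} (hh : |h| < δ) :
    (∫ x in cell kx ky, g.val x * η (x - h • basisVec i))
        - ∫ x in cell kx ky, g.val x * η (x - (0 : ℝ) • basisVec i)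
      = ∫ x in cell kx ky, η x * (g.val (x + h • basisVec i) - g.val x) := by
  have h1 := continuous_mul_translate hη h0
    (g.continuousOn_val.mono layer_subset_closedLayer) i hh
  have h2 : ContinuousOn (fun x => η x * g.val x) (cell kx ky) :=
    hη.continuousOn.mul g.continuousOn_cell
  rw [setIntegral_cell_translate hkx hky g.periodic_val hp h0 i hh]
  simp only [mul_sub]
  rw [integral_sub (h1.continuousOn.integrableOn_compact (isCompact_cell kx ky))
    (h2.integrableOn_compact (isCompact_cell kx ky))]
  simp only [zero_smul, sub_zero, mul_comm]

/-- By convexity the increment of the correlation is at most the increment of `∫ g.halfSq`, which is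
zero by translation invariance. -/
theorem PeriodicW22.NegNearBoundary.isLocalMax (hs : g.NegNearBoundary δ) (hkx : 0 < kx)
    (hky : 0 < ky) (hδ : 0 < δ) (i : Fin 3) :
    IsLocalMax (fun h : ℝ => ∫ x in cell kx ky, g.val x * g.pos (x - h • basisVec i)) 0 := by
  filter_upwards [Ioo_mem_nhds (neg_lt_zero.2 hδ) hδ] with h hh
  have hh' : |h| < δ := abs_lt.2 hh
  rw [← sub_nonpos, g.integral_translate_sub hkx hky (hs.continuous_pos hδ) g.periodic_pos
    hs.verticalSupport_pos i hh', ← hs.integral_halfSq_sub hkx hky hδ i hh']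
  exact setIntegral_mono_on ((hs.continuousOn_pos_mul hδ i hh').integrableOn_compact
      (isCompact_cell kx ky))
    ((hs.continuous_halfSq_sub hδ i h).continuousOn.integrableOn_compact (isCompact_cell kx ky))
    (measurableSet_cell kx ky) fun x _ => hs.pos_mul_sub_le hδ i hh' x

/-- The integral is the second derivative at `h = 0` of the correlation of `g` with `g.pos`, which
has a local maximum there. -/
theorem PeriodicW22.NegNearBoundary.integral_hess_mul_pos_nonpos (hs : g.NegNearBoundary δ)
    (hkx : 0 < kx) (hky : 0 < ky) (hδ : 0 < δ) (i : Fin 3) :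
    ∫ x in cell kx ky, g.hess i i x * g.pos x ≤ 0 := by
  have h1 : ∀ᶠ h in 𝓝 (0 : ℝ),
      HasDerivAt (fun h : ℝ => ∫ x in cell kx ky, g.val x * g.pos (x - h • basisVec i))
        (∫ x in cell kx ky, g.grad i x * g.pos (x - h • basisVec i)) h := by
    filter_upwards [Ioo_mem_nhds (neg_lt_zero.2 hδ) hδ] with h hh
    exact (g.weakDeriv_val i).hasDerivAt_setIntegral_cell hkx hky g.periodic_val
      (g.periodic_grad i) (hs.continuous_pos hδ) g.periodic_pos hs.verticalSupport_pos
      (abs_lt.2 hh)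
  have h2 := (g.weakDeriv_grad i i).hasDerivAt_setIntegral_cell hkx hky (g.periodic_grad i)
    (g.periodic_hess i i) (hs.continuous_pos hδ) g.periodic_pos hs.verticalSupport_pos
    (h := 0) (by simpa using hδ)
  simpa using nonpos_of_isLocalMax h1 h2 (hs.isLocalMax hkx hky hδ i)

/-- The chain rule `∫ v ∂ᵢg g₊ = -∫ ∂ᵢv g₊² / 2`. -/
theorem PeriodicW22.NegNearBoundary.integral_mul_grad_mul_pos (hs : g.NegNearBoundary δ)
    (hkx : 0 < kx) (hky : 0 < ky) (hδ : 0 < δ) (v : PeriodicW22 kx ky) (i : Fin 3) :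
    ∫ x in cell kx ky, v.val x * g.grad i x * g.pos x
      = -∫ x in cell kx ky, v.grad i x * g.halfSq x := by
  have hcp := hs.continuous_pos hδ
  have h00 : |(0 : ℝ)| < δ := by simpa using hδ
  set η : Space → ℝ := layer.indicator fun x => v.val x * max (g.val x) 0 with hη
  have hη0 : ∀ x ∈ closedLayer, v.val x * max (g.val x) 0 ≠ 0 → x 2 ∈ Set.Icc δ (1 - δ) :=
    fun x hx h => hs.max_ne_zero x hx (right_ne_zero_of_mul h)
  have hηc : Continuous η := continuous_indicator_layer hδ
    (v.continuousOn_val.mul (g.continuousOn_val.sup continuousOn_const)) hη0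
  have hηp : HorizontallyPeriodic kx ky η :=
    (v.periodic_val.mul (g.periodic_val.comp fun s => max s 0)).indicator_layer
  have hηs : VerticalSupport δ η := verticalSupport_indicator hη0
  have hηe : ∀ x, η x = v.val x * g.pos x := fun x => by
    rw [hη, pos, ← Set.indicator_mul_right]
  have hφ := (g.weakDeriv_val i).hasDerivAt_setIntegral_cell hkx hky g.periodic_val
    (g.periodic_grad i) hηc hηp hηs h00
  have hφ0 := (g.weakDeriv_val i).hasDerivAt_setIntegral_cell hkx hky g.periodic_val
    (g.periodic_grad i) hcp g.periodic_pos hs.verticalSupport_pos h00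
  have hzero := (hs.isLocalMax hkx hky hδ i).hasDerivAt_eq_zero hφ0
  rw [hzero] at hφ0
  have hψ' := (v.weakDeriv_val i).hasDerivAt_setIntegral_cell hkx hky v.periodic_val
    (v.periodic_grad i) (hs.continuous_halfSq hδ) g.periodic_halfSq hs.verticalSupport_halfSq
    h00
  -- The sign of `h` is reversed because the other correlation, rewritten on the cell, involves
  -- values at `x + h eᵢ`.
  have hψ : HasDerivAt
      (fun h : ℝ => ∫ x in cell kx ky, v.val x * g.halfSq (x - (-h) • basisVec i))
      (-∫ x in cell kx ky, v.grad i x * g.halfSq (x - (0 : ℝ) • basisVec i)) 0 := by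
    have h1 : HasDerivAt (fun h : ℝ => -h) (-1) 0 := (hasDerivAt_id 0).neg
    have h2 := HasDerivAt.comp_of_eq (0 : ℝ) hψ' h1 (by simp)
    rw [mul_neg_one] at h2
    exact h2
  obtain ⟨U, hU⟩ := (isCompact_cell kx ky).exists_bound_of_continuousOn v.continuousOn_cell
  -- Let `R ≥ 0` be the convexity remainder. The difference of the two correlations changes by `-∫ v
  -- R`, at most `U ∫ R` in absolute value, and `∫ R` is minus the change of the correlation of `g`
  -- with `g.pos`, whose derivative at `0` vanishes.
  have hdiff := hasDerivAt_zero_of_abs_le (C := U)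
    (φ := fun h : ℝ => (∫ x in cell kx ky, g.val x * η (x - h • basisVec i))
      - ∫ x in cell kx ky, v.val x * g.halfSq (x - (-h) • basisVec i)) hφ0 (by
    filter_upwards [Ioo_mem_nhds (neg_lt_zero.2 hδ) hδ] with h hh
    have hh' : |h| < δ := abs_lt.2 hh
    set R : Space → ℝ := fun x => g.halfSq (x + h • basisVec i) - g.halfSq x
      - g.pos x * (g.val (x + h • basisVec i) - g.val x) with hR
    have hRc : ContinuousOn R (cell kx ky) :=
      (hs.continuous_halfSq_sub hδ i h).continuousOn.sub (hs.continuousOn_pos_mul hδ i hh')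
    have hR0 : ∀ x, 0 ≤ R x := fun x => sub_nonneg.2 (hs.pos_mul_sub_le hδ i hh' x)
    have hRi := hRc.integrableOn_compact (isCompact_cell kx ky) (μ := volume)
    have e1 := g.integral_translate_sub hkx hky hηc hηp hηs i hh'
    have e2 := g.integral_translate_sub hkx hky hcp g.periodic_pos hs.verticalSupport_pos i hh'
    have hc1 : ContinuousOn (fun x => v.val x * g.halfSq (x + h • basisVec i)) (cell kx ky) :=
      v.continuousOn_cell.mul
        ((hs.continuous_halfSq hδ).comp (by fun_prop)).continuousOn
    have hc0 : ContinuousOn (fun x => v.val x * g.halfSq x) (cell kx ky) :=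
      v.continuousOn_cell.mul (hs.continuous_halfSq hδ).continuousOn
    have e3 : (∫ x in cell kx ky, v.val x * g.halfSq (x - (-h) • basisVec i))
        - ∫ x in cell kx ky, v.val x * g.halfSq (x - (-(0 : ℝ)) • basisVec i)
        = ∫ x in cell kx ky, v.val x * (g.halfSq (x + h • basisVec i) - g.halfSq x) := by
      simp only [mul_sub, neg_smul, sub_neg_eq_add, neg_zero, zero_smul, sub_zero]
      rw [integral_sub (hc1.integrableOn_compact (isCompact_cell kx ky))
        (hc0.integrableOn_compact (isCompact_cell kx ky))]
    have hc2 : ContinuousOn (fun x => v.val x * (g.halfSq (x + h • basisVec i) - g.halfSq x))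
        (cell kx ky) :=
      v.continuousOn_cell.mul (hs.continuous_halfSq_sub hδ i h).continuousOn
    have hc3 : ContinuousOn (fun x => η x * (g.val (x + h • basisVec i) - g.val x))
        (cell kx ky) := by
      simp only [hηe, mul_assoc]
      exact v.continuousOn_cell.mul (hs.continuousOn_pos_mul hδ i hh')
    have e4 : (∫ x in cell kx ky, η x * (g.val (x + h • basisVec i) - g.val x))
        - ∫ x in cell kx ky, v.val x * (g.halfSq (x + h • basisVec i) - g.halfSq x)
        = -∫ x in cell kx ky, v.val x * R x := by
      rw [← integral_sub (hc3.integrableOn_compact (isCompact_cell kx ky))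
        (hc2.integrableOn_compact (isCompact_cell kx ky)), ← integral_neg]
      refine integral_congr_ae (Eventually.of_forall fun x => ?_)
      simp only [hR, hηe]
      ring
    have e5 : (∫ x in cell kx ky, g.pos x * (g.val (x + h • basisVec i) - g.val x))
        = -∫ x in cell kx ky, R x := by
      rw [hR, integral_sub ((hs.continuous_halfSq_sub hδ i h).continuousOn.integrableOn_compact
        (isCompact_cell kx ky)) ((hs.continuousOn_pos_mul hδ i hh').integrableOn_compact
        (isCompact_cell kx ky)), hs.integral_halfSq_sub hkx hky hδ i hh']
      ring
    rw [e2, e5, abs_neg, abs_of_nonneg (integral_nonneg hR0)]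
    rw [show ∀ a b c d : ℝ, a - b - (c - d) = (a - c) - (b - d) by intros; ring, e1, e3, e4,
      abs_neg, ← Real.norm_eq_abs, ← integral_const_mul]
    refine norm_integral_le_of_norm_le (hRi.const_mul U) ?_
    filter_upwards [ae_restrict_mem (measurableSet_cell kx ky)] with x hx
    rw [norm_mul, Real.norm_of_nonneg (hR0 x)]
    exact mul_le_mul_of_nonneg_right (hU x hx) (hR0 x))
  have huniq := (hφ.sub hψ).unique hdiff
  simp only [zero_smul, sub_zero, hηe, sub_neg_eq_add] at huniq
  rw [← eq_neg_iff_add_eq_zero] at huniq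
  rw [← huniq]
  refine integral_congr_ae (Eventually.of_forall fun x => ?_)
  simp only
  ring

end Support

/-! ### The diffusion and transport terms of the energy balance. -/

section Energy

variable {kx ky : ℝ} {g : PeriodicW22 kx ky}

instance : IsFiniteMeasure (cellMeasure kx ky) :=
  ⟨by rw [cellMeasure, Measure.restrict_apply_univ]; exact (isCompact_cell kx ky).measure_lt_top⟩

theorem integrable_mul_of_memLp {f v : Space → ℝ} (hf : MemLp f 2 (cellMeasure kx ky))
    (hv : ContinuousOn v (cell kx ky)) :
    Integrable (fun x => f x * v x) (cellMeasure kx ky) :=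
  IntegrableOn.mul_continuousOn (hf.integrable (by norm_num)) hv (isCompact_cell kx ky)

theorem PeriodicW22.continuousOn_max : ContinuousOn (fun x => max (g.val x) 0) (cell kx ky) :=
  g.continuousOn_cell.sup continuousOn_const

theorem PeriodicW22.memLp_lap : MemLp g.lap 2 (cellMeasure kx ky) := by
  have := memLp_finsetSum (p := 2) (μ := cellMeasure kx ky) Finset.univ
    (f := fun j x => g.hess j j x) fun j _ => g.memLp_hess j j
  simpa [PeriodicW22.lap] using! this

/-- Diffusion dissipates the truncated energy. -/
theorem PeriodicW22.integral_lap_mul_max_nonpos (hkx : 0 < kx) (hky : 0 < ky)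
    (hb : ∀ x : Space, x 2 = 0 ∨ x 2 = 1 → g.val x < 0) :
    ∫ x, g.lap x * max (g.val x) 0 ∂(cellMeasure kx ky) ≤ 0 := by
  obtain ⟨δ, hδ, hs⟩ :=
    g.periodic_val.exists_pos_of_neg_boundary hkx hky g.continuousOn_val hb
  have hs' : g.NegNearBoundary δ := hs
  have h1 : ∀ j, ∫ x in cell kx ky, g.hess j j x * max (g.val x) 0 ≤ 0 := fun j => by
    refine (setIntegral_congr_fun (measurableSet_cell kx ky) fun x hx => ?_).trans_le
      (hs'.integral_hess_mul_pos_nonpos hkx hky hδ j)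
    simp only [hs'.pos_eq hδ hx]
  simp only [lap, Finset.sum_mul]
  rw [integral_finsetSum _ fun j _ =>
    integrable_mul_of_memLp (g.memLp_hess j j) g.continuousOn_max]
  exact Finset.sum_nonpos fun j _ => h1 j

/-- Transport by a solenoidal field preserves the truncated energy. -/
theorem PeriodicW22.integral_transport_mul_max (hkx : 0 < kx) (hky : 0 < ky)
    (hb : ∀ x : Space, x 2 = 0 ∨ x 2 = 1 → g.val x < 0) (u : Fin 3 → PeriodicW22 kx ky)
    (hdiv : ∀ᵐ x ∂(cellMeasure kx ky), ∑ i, (u i).grad i x = 0) :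
    ∫ x, (∑ i, (u i).val x * g.grad i x) * max (g.val x) 0 ∂(cellMeasure kx ky) = 0 := by
  obtain ⟨δ, hδ, hs⟩ :=
    g.periodic_val.exists_pos_of_neg_boundary hkx hky g.continuousOn_val hb
  have hs' : g.NegNearBoundary δ := hs
  have h1 : ∀ i, ∫ x in cell kx ky, (u i).val x * g.grad i x * max (g.val x) 0
      = -∫ x in cell kx ky, (u i).grad i x * g.halfSq x := fun i => by
    rw [← hs'.integral_mul_grad_mul_pos hkx hky hδ (u i) i]
    refine setIntegral_congr_fun (measurableSet_cell kx ky) fun x hx => ?_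
    simp only [hs'.pos_eq hδ hx]
  have hi : ∀ i, Integrable (fun x => (u i).val x * g.grad i x * max (g.val x) 0)
      (cellMeasure kx ky) := fun i => by
    refine (integrable_mul_of_memLp (g.memLp_grad i)
      ((u i).continuousOn_cell.mul g.continuousOn_max)).congr (Eventually.of_forall fun x => ?_)
    simp only [Pi.mul_apply]
    ring
  simp only [Finset.sum_mul]
  rw [integral_finsetSum _ fun i _ => hi i]
  have h2 : ∀ i, ∫ x, (u i).val x * g.grad i x * max (g.val x) 0 ∂(cellMeasure kx ky)
      = -∫ x, (u i).grad i x * g.halfSq x ∂(cellMeasure kx ky) := h1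
  simp only [h2]
  rw [Finset.sum_neg_distrib, ← integral_finsetSum _ fun i _ =>
    integrable_mul_of_memLp ((u i).memLp_grad i) (hs'.continuous_halfSq hδ).continuousOn]
  simp only [← Finset.sum_mul]
  rw [integral_eq_zero_of_ae, neg_zero]
  filter_upwards [hdiv] with x hx
  simp [hx]

end Energy

/-! ### Differentiability of `‖v₊‖² / 2` on `L²`. -/

section L2

variable {α : Type*} [MeasurableSpace α] {μ : Measure α}

theorem abs_posPart_remainder_le (a b : ℝ) :
    |max b 0 * max b 0 / 2 - max a 0 * max a 0 / 2 - max a 0 * (b - a)|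
      ≤ (b - a) * (b - a) / 2 := by
  rcases le_total a 0 with ha | ha <;> rcases le_total b 0 with hb | hb <;>
    simp only [ha, hb, max_eq_left, max_eq_right] <;> rw [abs_le]
  · constructor <;> nlinarith [mul_self_nonneg (b - a)]
  · constructor <;> nlinarith [mul_nonneg_of_nonpos_of_nonpos ha (sub_nonpos.2 (ha.trans hb)),
      mul_nonneg hb (neg_nonneg.2 ha), mul_self_nonneg (b - a), mul_self_nonneg b]
  · constructor <;> nlinarith [mul_nonneg ha (neg_nonneg.2 hb), mul_self_nonneg (b - a),
      mul_self_nonneg a, mul_self_nonneg b]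
  · constructor <;> nlinarith [mul_self_nonneg (b - a)]

theorem abs_halfSq_posPart_sub_le (v w : Lp ℝ 2 μ) :
    |‖Lp.posPart w‖ ^ 2 / 2 - ‖Lp.posPart v‖ ^ 2 / 2 - inner ℝ (Lp.posPart v) (w - v)|
      ≤ ‖w - v‖ ^ 2 / 2 := by
  simp only [← real_inner_self_eq_norm_sq, L2.inner_def]
  simp only [← integral_div]
  have i1 := (L2.integrable_inner (𝕜 := ℝ) (Lp.posPart w) (Lp.posPart w)).div_const 2
  have i2 := (L2.integrable_inner (𝕜 := ℝ) (Lp.posPart v) (Lp.posPart v)).div_const 2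
  have i3 := L2.integrable_inner (𝕜 := ℝ) (Lp.posPart v) (w - v)
  have i4 := (L2.integrable_inner (𝕜 := ℝ) (w - v) (w - v)).div_const 2
  have e := (integral_sub (i1.sub i2) i3).trans
    (congrArg (· - ∫ a, inner ℝ ((Lp.posPart v) a) ((w - v) a) ∂μ) (integral_sub i1 i2))
  rw [← e, ← Real.norm_eq_abs]
  refine norm_integral_le_of_norm_le i4 ?_
  filter_upwards [Lp.coeFn_posPart v, Lp.coeFn_posPart w, Lp.coeFn_sub w v] with x hv hw hs
  simp only [Pi.sub_apply, hv, hw, hs, RCLike.inner_apply, conj_trivial, Real.norm_eq_abs]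
  rw [mul_comm (w x - v x) (max (v x) 0)]
  exact abs_posPart_remainder_le (v x) (w x)

/-- The pointwise first-order remainder of `s₊² / 2` is at most half the squared increment, so after
integration it is quadratic in the `L²` norm. -/
theorem hasFDerivAt_halfSq_posPart (v : Lp ℝ 2 μ) :
    HasFDerivAt (fun w : Lp ℝ 2 μ => ‖Lp.posPart w‖ ^ 2 / 2)
      (innerSL ℝ (Lp.posPart v)) v := by
  rw [hasFDerivAt_iff_isLittleO]
  have h1 : (fun w : Lp ℝ 2 μ => ‖Lp.posPart w‖ ^ 2 / 2 - ‖Lp.posPart v‖ ^ 2 / 2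
      - innerSL ℝ (Lp.posPart v) (w - v)) =O[𝓝 v] fun w => ‖w - v‖ ^ 2 := by
    refine Asymptotics.IsBigO.of_bound (1 / 2) (Eventually.of_forall fun w => ?_)
    rw [innerSL_apply_apply, Real.norm_eq_abs, Real.norm_of_nonneg (by positivity)]
    linarith [abs_halfSq_posPart_sub_le v w]
  refine h1.trans_isLittleO ?_
  have h2 : Tendsto (fun w : Lp ℝ 2 μ => w - v) (𝓝 v) (𝓝 0) := by
    simpa using (tendsto_id (x := 𝓝 v)).sub_const v
  exact (Asymptotics.isLittleO_norm_pow_id one_lt_two).comp_tendsto h2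

end L2

/-! ### Fields as curves in `L²`. -/

section Curve

variable {kx ky : ℝ}

theorem memLp_of_continuousOn_cell {v : Space → ℝ} (hv : ContinuousOn v (cell kx ky)) :
    MemLp v 2 (cellMeasure kx ky) := by
  obtain ⟨C, hC⟩ := (isCompact_cell kx ky).exists_bound_of_continuousOn hv
  refine MemLp.of_bound (hv.aestronglyMeasurable (measurableSet_cell kx ky)) C ?_
  filter_upwards [ae_restrict_mem (measurableSet_cell kx ky)] with x hx using hC x hx

theorem PeriodicW22.memLp_val (g : PeriodicW22 kx ky) : MemLp g.val 2 (cellMeasure kx ky) :=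
  memLp_of_continuousOn_cell g.continuousOn_cell

/-- The field as an element of `L²(Ω)`. -/
noncomputable def PeriodicW22.toL2 (g : PeriodicW22 kx ky) : Lp ℝ 2 (cellMeasure kx ky) :=
  g.memLp_val.toLp g.val

theorem HasL2TimeDeriv.hasDerivAt_toL2 {g : ℝ → PeriodicW22 kx ky} {g' : Space → ℝ} {t : ℝ}
    (h : HasL2TimeDeriv kx ky (fun s => (g s).val) g' t) :
    HasDerivAt (fun s => (g s).toL2) (h.1.toLp g') t := by
  rw [hasDerivAt_iff_tendsto_slope_zero, tendsto_iff_norm_sub_tendsto_zero]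
  have h1 := (ENNReal.tendsto_toReal ENNReal.zero_ne_top).comp h.2
  rw [ENNReal.toReal_zero] at h1
  refine h1.congr fun s => ?_
  have e : s⁻¹ • ((g (t + s)).toL2 - (g t).toL2) - h.1.toLp g'
      = ((((g (t + s)).memLp_val.sub (g t).memLp_val).const_smul s⁻¹).sub h.1).toLp _ := rfl
  rw [e, Lp.norm_toLp]
  simp only [Function.comp]
  congr 2
  funext x
  simp [div_eq_inv_mul]

theorem AttainsInitial.tendsto_toL2 {g : ℝ → PeriodicW22 kx ky} {g₀ : Space → ℝ}
    (h : AttainsInitial kx ky (fun s => (g s).val) g₀) (hg₀ : MemLp g₀ 2 (cellMeasure kx ky)) :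
    Tendsto (fun s => (g s).toL2) (𝓝[>] 0) (𝓝 (hg₀.toLp g₀)) := by
  rw [tendsto_iff_norm_sub_tendsto_zero]
  have h1 := (ENNReal.tendsto_toReal ENNReal.zero_ne_top).comp h
  rw [ENNReal.toReal_zero] at h1
  refine h1.congr fun s => ?_
  have e : (g s).toL2 - hg₀.toLp g₀ = ((g s).memLp_val.sub hg₀).toLp _ := rfl
  rw [e, Lp.norm_toLp]
  rfl

end Curve

/-! ### Subtraction of an affine profile and a time-dependent level. -/

section Affine

theorem HasWeakDeriv.add {U : Set Space} {i : Fin 3} {f f' g g' : Space → ℝ}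
    (hf : HasWeakDeriv U i f f') (hg : HasWeakDeriv U i g g') :
    HasWeakDeriv U i (fun x => f x + g x) (fun x => f' x + g' x) := by
  refine ⟨hf.1.add hg.1, hf.2.1.add hg.2.1, fun ψ h1 h2 h3 => ?_⟩
  have hpc : Continuous (pderiv i ψ) := continuous_pderiv h1
  have hps : Function.support (pderiv i ψ) ⊆ tsupport ψ := support_pderiv_subset
  have key : ∀ {q η : Space → ℝ}, LocallyIntegrableOn q U → Continuous η →
      Function.support η ⊆ tsupport ψ → IntegrableOn (fun x => q x * η x) U :=
    fun hq hη hs => (integrable_mul_of_support_subset h2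
      (hq.integrableOn_compact_subset h3 h2) hη hs).integrableOn
  have hψ := subset_tsupport ψ
  simp only [add_mul]
  rw [integral_add (key hf.1 hpc hps) (key hg.1 hpc hps),
    integral_add (key hf.2.1 h1.continuous hψ) (key hg.2.1 h1.continuous hψ),
    hf.2.2 ψ h1 h2 h3, hg.2.2 ψ h1 h2 h3]
  ring

theorem hasWeakDeriv_affine (Ra c : ℝ) (i : Fin 3) :
    HasWeakDeriv layer i (fun x => Ra * x 2 - c) (fun _ => if i = 2 then Ra else 0) := by
  have hc : Continuous fun x : Space => Ra * x 2 - c := by fun_prop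
  refine ⟨hc.locallyIntegrable.locallyIntegrableOn _,
    (locallyIntegrable_const _).locallyIntegrableOn _, fun ψ h1 h2 h3 => ?_⟩
  have hd : ∀ x : Space, HasFDerivAt (fun x : Space => Ra * x 2 - c)
      (Ra • ContinuousLinearMap.proj (R := ℝ) (φ := fun _ : Fin 3 => ℝ) 2) x := fun x =>
    ((hasFDerivAt_apply (𝕜 := ℝ) (2 : Fin 3) x).const_mul Ra).sub_const c
  have hv : ∀ x : Space, fderiv ℝ (fun x : Space => Ra * x 2 - c) x (basisVec i)
      = if i = 2 then Ra else 0 := fun x => by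
    rw [(hd x).fderiv]
    by_cases hi : i = 2
    · subst hi; simp
    · simp [hi, Ne.symm hi]
  have hpc : Continuous (pderiv i ψ) := continuous_pderiv h1
  have hps : Function.support (pderiv i ψ) ⊆ tsupport ψ := support_pderiv_subset
  have hout : ∀ x ∉ layer, ψ x = 0 ∧ pderiv i ψ x = 0 := by
    intro x hx
    constructor <;> by_contra h0
    · exact hx (h3 (subset_tsupport _ h0))
    · exact hx (h3 (hps h0))
  rw [setIntegral_eq_integral_of_forall_compl_eq_zero fun x hx => by simp [(hout x hx).2],
    setIntegral_eq_integral_of_forall_compl_eq_zero fun x hx => by simp [(hout x hx).1]]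
  have hpi : HasCompactSupport (pderiv i ψ) := h2.mono' hps
  have := integral_mul_fderiv_eq_neg_fderiv_mul_of_integrable (μ := (volume : Measure Space))
    (f := fun x : Space => Ra * x 2 - c) (g := ψ) (v := basisVec i)
    (by simp only [hv]; exact (h1.continuous.integrable_of_hasCompactSupport h2).const_mul _)
    ((hc.mul hpc).integrable_of_hasCompactSupport hpi.mul_left)
    ((hc.mul h1.continuous).integrable_of_hasCompactSupport h2.mul_left)
    (fun x _ => (hd x).differentiableAt) (fun x _ => h1.differentiable (by simp) x)
  simp only [hv] at this
  exact this

variable {kx ky : ℝ}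

/-- The field `g + Ra z - c`. -/
noncomputable def PeriodicW22.shift (g : PeriodicW22 kx ky) (Ra c : ℝ) : PeriodicW22 kx ky where
  val x := g.val x + (Ra * x 2 - c)
  grad i x := g.grad i x + if i = 2 then Ra else 0
  hess := g.hess
  continuousOn_val := g.continuousOn_val.add (by fun_prop)
  periodic_val := ⟨fun x => by simp [g.periodic_val.1 x], fun x => by simp [g.periodic_val.2 x]⟩
  periodic_grad i := ⟨fun x => by simp [(g.periodic_grad i).1 x],
    fun x => by simp [(g.periodic_grad i).2 x]⟩
  periodic_hess := g.periodic_hess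
  memLp_grad i := (g.memLp_grad i).add (memLp_const _)
  memLp_hess := g.memLp_hess
  weakDeriv_val i := (g.weakDeriv_val i).add (hasWeakDeriv_affine Ra c i)
  weakDeriv_grad i j := by
    have h0 : HasWeakDeriv layer j (fun _ => if i = 2 then Ra else 0) (fun _ => 0) := by
      -- With slope zero the affine function is the constant needed here.
      have := hasWeakDeriv_affine 0 (-(if i = 2 then Ra else 0)) j
      simpa using this
    simpa using (g.weakDeriv_grad i j).add h0

theorem memLp_affine (Ra c : ℝ) : MemLp (fun x : Space => Ra * x 2 - c) 2 (cellMeasure kx ky) :=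
  memLp_of_continuousOn_cell (by fun_prop)

theorem PeriodicW22.toL2_shift (g : PeriodicW22 kx ky) (Ra b m : ℝ) :
    (g.shift Ra (b + m)).toL2 = g.toL2 + (memLp_affine Ra b).toLp _
      - m • (memLp_const (1 : ℝ)).toLp (fun _ : Space => (1 : ℝ)) := by
  have e : g.toL2 + (memLp_affine Ra b).toLp _
      - m • (memLp_const (1 : ℝ)).toLp (fun _ : Space => (1 : ℝ))
      = ((g.memLp_val.add (memLp_affine Ra b)).sub ((memLp_const (1 : ℝ)).const_smul m)).toLp _ :=
    rfl
  rw [e, toL2]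
  congr 1
  funext x
  simp [shift]
  ring

theorem HasL2TimeDeriv.hasDerivAt_energy {g : ℝ → PeriodicW22 kx ky} {g' : Space → ℝ} {t m' : ℝ}
    {m : ℝ → ℝ} (h : HasL2TimeDeriv kx ky (fun s => (g s).val) g' t) (hm : HasDerivAt m m' t)
    (Ra b : ℝ) :
    HasDerivAt (fun s => ‖Lp.posPart ((g s).shift Ra (b + m s)).toL2‖ ^ 2 / 2)
      (∫ x, (g' x - m') * max (((g t).shift Ra (b + m t)).val x) 0 ∂(cellMeasure kx ky)) t := by
  have h1 : HasDerivAt (fun s => ((g s).shift Ra (b + m s)).toL2)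
      (h.1.toLp g' - m' • (memLp_const (1 : ℝ)).toLp (fun _ : Space => (1 : ℝ))) t := by
    simp only [PeriodicW22.toL2_shift]
    exact (h.hasDerivAt_toL2.add_const _).sub (hm.smul_const _)
  have h2 := (hasFDerivAt_halfSq_posPart _).comp_hasDerivAt t h1
  refine h2.congr_deriv ?_
  rw [innerSL_apply_apply, L2.inner_def]
  have e : h.1.toLp g' - m' • (memLp_const (1 : ℝ)).toLp (fun _ : Space => (1 : ℝ))
      = (h.1.sub ((memLp_const (1 : ℝ)).const_smul m')).toLp _ := rfl
  rw [e]
  refine integral_congr_ae ?_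
  filter_upwards [Lp.coeFn_posPart ((g t).shift Ra (b + m t)).toL2,
    MemLp.coeFn_toLp (h.1.sub ((memLp_const (1 : ℝ)).const_smul m')),
    MemLp.coeFn_toLp ((g t).shift Ra (b + m t)).memLp_val] with x h1 h2 h3
  rw [h1, h2, PeriodicW22.toL2, h3]
  simp [RCLike.inner_apply]

/-- The truncated energy is continuous on `L²`, and the limit of the shifted curve has zero positive
part because the initial datum lies below the level. -/
theorem AttainsInitial.tendsto_energy {g : ℝ → PeriodicW22 kx ky} {g₀ : Space → ℝ} {m : ℝ → ℝ}
    {m₀ Ra b : ℝ} (h : AttainsInitial kx ky (fun s => (g s).val) g₀)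
    (hg₀ : MemLp g₀ 2 (cellMeasure kx ky)) (hm : Tendsto m (𝓝[>] 0) (𝓝 m₀))
    (hle : ∀ᵐ x ∂(cellMeasure kx ky), g₀ x + (Ra * x 2 - b) ≤ m₀) :
    Tendsto (fun s => ‖Lp.posPart ((g s).shift Ra (b + m s)).toL2‖ ^ 2 / 2) (𝓝[>] 0) (𝓝 0) := by
  have h1 : Tendsto (fun s => ((g s).shift Ra (b + m s)).toL2) (𝓝[>] 0)
      (𝓝 (hg₀.toLp g₀ + (memLp_affine Ra b).toLp _
        - m₀ • (memLp_const (1 : ℝ)).toLp (fun _ : Space => (1 : ℝ)))) := by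
    simp only [PeriodicW22.toL2_shift]
    exact ((h.tendsto_toL2 hg₀).add_const _).sub (hm.smul_const _)
  have h2 := (hasFDerivAt_halfSq_posPart _).continuousAt.tendsto.comp h1
  set w := hg₀.toLp g₀ + (memLp_affine Ra b).toLp _
        - m₀ • (memLp_const (1 : ℝ)).toLp (fun _ : Space => (1 : ℝ)) with hw
  have e : w = ((hg₀.add (memLp_affine Ra b)).sub ((memLp_const (1 : ℝ)).const_smul m₀)).toLp _ :=
    rfl
  have h3 : Lp.posPart w = 0 := by
    rw [Lp.eq_zero_iff_ae_eq_zero]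
    filter_upwards [Lp.coeFn_posPart w, MemLp.coeFn_toLp ((hg₀.add (memLp_affine Ra b)).sub
      ((memLp_const (1 : ℝ)).const_smul m₀)), hle] with x h4 h5 h6
    rw [h4, e, h5]
    simpa using h6
  have hF : ‖Lp.posPart w‖ ^ 2 / 2 = 0 := by simp [h3]
  rw [hF] at h2
  exact h2

end Affine

/-! ### Comparison with spatially constant solutions. -/

section Comparison

theorem nonpos_of_deriv_nonpos_of_tendsto {E E' : ℝ → ℝ} (h : ∀ t > 0, HasDerivAt E (E' t) t)
    (h' : ∀ t > 0, E' t ≤ 0) (h0 : Tendsto E (𝓝[>] 0) (𝓝 0)) {t : ℝ} (ht : 0 < t) :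
    E t ≤ 0 := by
  have hanti : AntitoneOn E (Set.Ioi 0) := by
    refine antitoneOn_of_deriv_nonpos (convex_Ioi 0)
      (fun s hs => (h s hs).continuousAt.continuousWithinAt) ?_ ?_
    · intro s hs
      rw [interior_Ioi] at hs
      exact (h s hs).differentiableAt.differentiableWithinAt
    · intro s hs
      rw [interior_Ioi] at hs
      rw [(h s hs).deriv]
      exact h' s hs
  refine ge_of_tendsto h0 ?_
  filter_upwards [Ioo_mem_nhdsGT ht] with s hs
  exact hanti hs.1 ht hs.2.le

variable {kx ky Ra Da ζ H A γ : ℝ} {u : ℝ → Fin 3 → PeriodicW22 kx ky}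
  {p θ φ : ℝ → PeriodicW22 kx ky} {θ₀ φ₀ : Space → ℝ}

/-- The dissipation of the truncated energy, at a fixed time. -/
theorem energy_dissipation (hkx : 0 < kx) (hky : 0 < ky) (hH : 0 ≤ H) (hγ : 0 < γ)
    {v : Fin 3 → PeriodicW22 kx ky} {S T : PeriodicW22 kx ky} {S' T' : Space → ℝ}
    (hS' : MemLp S' 2 (cellMeasure kx ky)) (hT' : MemLp T' 2 (cellMeasure kx ky))
    (hSb : ∀ x : Space, x 2 = 0 ∨ x 2 = 1 → S.val x < 0)
    (hTb : ∀ x : Space, x 2 = 0 ∨ x 2 = 1 → T.val x < 0)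
    (hdiv : ∀ᵐ x ∂(cellMeasure kx ky), ∑ i, (v i).grad i x = 0)
    (hS : ∀ᵐ x ∂(cellMeasure kx ky),
      S' x + ∑ i, (v i).val x * S.grad i x = S.lap x + H * (T.val x - S.val x))
    (hT : ∀ᵐ x ∂(cellMeasure kx ky),
      A * T' x = T.lap x - H * γ * (T.val x - S.val x)) :
    γ * ∫ x, S' x * max (S.val x) 0 ∂(cellMeasure kx ky)
      + A * ∫ x, T' x * max (T.val x) 0 ∂(cellMeasure kx ky) ≤ 0 := by
  have hcS := S.continuousOn_max
  have hcT := T.continuousOn_max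
  have i1 := integrable_mul_of_memLp hS' hcS
  have i2 := integrable_mul_of_memLp hT' hcT
  have i3 := integrable_mul_of_memLp S.memLp_lap hcS
  have i4 := integrable_mul_of_memLp T.memLp_lap hcT
  have i5 : Integrable (fun x => (∑ i, (v i).val x * S.grad i x) * max (S.val x) 0)
      (cellMeasure kx ky) := by
    simp only [Finset.sum_mul]
    refine integrable_finsetSum _ fun i _ => ?_
    refine (integrable_mul_of_memLp (S.memLp_grad i)
      ((v i).continuousOn_cell.mul hcS)).congr (Eventually.of_forall fun x => ?_)
    simp only [Pi.mul_apply]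
    ring
  have hl1 := S.integral_lap_mul_max_nonpos hkx hky hSb
  have hl2 := T.integral_lap_mul_max_nonpos hkx hky hTb
  have hl3 := S.integral_transport_mul_max hkx hky hSb v hdiv
  have key : ∫ x, (γ * (S' x * max (S.val x) 0) + A * (T' x * max (T.val x) 0))
      ∂(cellMeasure kx ky) ≤
      ∫ x, (γ * (S.lap x * max (S.val x) 0) + T.lap x * max (T.val x) 0
        - γ * ((∑ i, (v i).val x * S.grad i x) * max (S.val x) 0)) ∂(cellMeasure kx ky) := by
    refine integral_mono_ae ((i1.const_mul γ).add (i2.const_mul A))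
      (((i3.const_mul γ).add i4).sub (i5.const_mul γ)) ?_
    filter_upwards [hS, hT] with x h1 h2
    -- Monotonicity of the positive part; with the weights `γ` and `A`, the two exchange terms
    -- combine into `-H γ` times this product.
    have h3 : 0 ≤ (S.val x - T.val x) * (max (S.val x) 0 - max (T.val x) 0) := by
      rcases le_total (S.val x) (T.val x) with h | h
      · exact mul_nonneg_of_nonpos_of_nonpos (sub_nonpos.2 h)
          (sub_nonpos.2 (max_le_max_right 0 h))
      · exact mul_nonneg (sub_nonneg.2 h) (sub_nonneg.2 (max_le_max_right 0 h))
    have h4 : 0 ≤ H * γ * ((S.val x - T.val x) * (max (S.val x) 0 - max (T.val x) 0)) :=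
      mul_nonneg (mul_nonneg hH hγ.le) h3
    have e1 : S' x = S.lap x + H * (T.val x - S.val x) - ∑ i, (v i).val x * S.grad i x := by
      linarith
    have e2 : A * (T' x * max (T.val x) 0)
        = (T.lap x - H * γ * (T.val x - S.val x)) * max (T.val x) 0 := by
      rw [← h2]; ring
    rw [e2, e1]
    nlinarith [h4]
  rw [integral_add (i1.const_mul γ) (i2.const_mul A), integral_const_mul, integral_const_mul]
    at key
  refine key.trans ?_
  have e := integral_sub ((i3.const_mul γ).add i4) (i5.const_mul γ)
  simp only [Pi.add_apply] at e
  rw [e, integral_const_mul, hl3, mul_zero, sub_zero, integral_add (i3.const_mul γ) i4,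
    integral_const_mul]
  nlinarith [mul_nonneg hγ.le (neg_nonneg.2 hl1)]

theorem closure_interior_cell (hkx : 0 < kx) (hky : 0 < ky) :
    cell kx ky ⊆ closure (interior (cell kx ky)) := by
  have hax : 0 < 2 * Real.pi / kx := by positivity
  have hay : 0 < 2 * Real.pi / ky := by positivity
  have h : Convex ℝ (cell kx ky) := cell_eq_Icc kx ky ▸ convex_Icc _ _
  rw [h.closure_interior_eq_closure_of_nonempty_interior]
  · exact subset_closure
  · rw [cell_eq_Icc, ← Set.pi_univ_Icc, interior_pi_set Set.finite_univ, Set.univ_pi_nonempty_iff]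
    intro i
    rw [interior_Icc, Set.nonempty_Ioo]
    fin_cases i
    · simpa using hax
    · simpa using hay
    · simp

/-- Continuity upgrades the almost everywhere bound to every point, the cell being contained in the
closure of its interior. -/
theorem PeriodicW22.le_zero_of_posPart_eq_zero (hkx : 0 < kx) (hky : 0 < ky)
    {g : PeriodicW22 kx ky} (h : Lp.posPart g.toL2 = 0) {x : Space} (hx : x ∈ cell kx ky) :
    g.val x ≤ 0 := by
  have h1 : (fun x => max (g.val x) 0) =ᵐ[volume.restrict (cell kx ky)] fun _ => 0 := by
    rw [Lp.eq_zero_iff_ae_eq_zero] at h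
    filter_upwards [h, Lp.coeFn_posPart g.toL2, MemLp.coeFn_toLp g.memLp_val] with y h1 h2 h3
    rw [h2, toL2, h3] at h1
    exact h1
  have h2 := Measure.eqOn_of_ae_eq h1 g.continuousOn_max continuousOn_const
    (closure_interior_cell hkx hky) hx
  exact (le_max_left _ _).trans h2.le

/-- Comparison of the temperatures with spatially constant solutions `(M, N)` of the system. -/
theorem IsPerturbation.fluid_le (hkx : 0 < kx) (hky : 0 < ky) (hRa : 0 < Ra) (hH : 0 ≤ H)
    (hA : 0 < A) (hγ : 0 < γ) (hsol : IsPerturbation Ra Da ζ H A γ u p θ φ θ₀ φ₀)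
    (hθ₀ : MemLp θ₀ 2 (cellMeasure kx ky)) (hφ₀ : MemLp φ₀ 2 (cellMeasure kx ky))
    {M N : ℝ → ℝ} {M₀ N₀ : ℝ} (hM : ∀ t > 0, HasDerivAt M (H * (N t - M t)) t)
    (hN : ∀ t > 0, HasDerivAt N (-(H * γ / A) * (N t - M t)) t)
    (hMpos : ∀ t > 0, 0 < M t) (hNpos : ∀ t > 0, 0 < N t)
    (hM₀ : Tendsto M (𝓝[>] 0) (𝓝 M₀)) (hN₀ : Tendsto N (𝓝[>] 0) (𝓝 N₀))
    (hθM : ∀ᵐ x ∂(cellMeasure kx ky), θ₀ x + (Ra * x 2 - Ra) ≤ M₀)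
    (hφN : ∀ᵐ x ∂(cellMeasure kx ky), φ₀ x + (Ra * x 2 - Ra) ≤ N₀)
    {t : ℝ} (ht : 0 < t) {x : Space} (hx : x ∈ cell kx ky) :
    (θ t).val x + (Ra * x 2 - Ra) ≤ M t := by
  set S : ℝ → PeriodicW22 kx ky := fun s => (θ s).shift Ra (Ra + M s) with hS
  set T : ℝ → PeriodicW22 kx ky := fun s => (φ s).shift Ra (Ra + N s) with hT
  choose! θ' hθ' hθe using hsol.fluid_energy
  choose! φ' hφ' hφe using hsol.solid_energy
  -- At the planes the shifted field equals `Ra z - Ra - c` with `Ra z ≤ Ra`; positivity of `c`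
  -- makes this strictly negative even at `z = 1`.
  have hbdry : ∀ (g : PeriodicW22 kx ky) (c : ℝ), 0 < c →
      (∀ x : Space, x 2 = 0 ∨ x 2 = 1 → g.val x = 0) →
      ∀ x : Space, x 2 = 0 ∨ x 2 = 1 → (g.shift Ra (Ra + c)).val x < 0 := by
    intro g c hc hg x hx
    have h0 := hg x hx
    simp only [PeriodicW22.shift, h0]
    rcases hx with h | h <;> rw [h] <;> linarith
  have hE := nonpos_of_deriv_nonpos_of_tendsto
    (E := fun s => γ * (‖Lp.posPart (S s).toL2‖ ^ 2 / 2) + A * (‖Lp.posPart (T s).toL2‖ ^ 2 / 2))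
    (fun s hs => (((hθ' s hs).hasDerivAt_energy (hM s hs) Ra Ra).const_mul γ).add
      (((hφ' s hs).hasDerivAt_energy (hN s hs) Ra Ra).const_mul A))
    (fun s hs => by
      refine energy_dissipation hkx hky hH hγ (v := u s) (S := S s) (T := T s)
        ((hθ' s hs).1.sub (memLp_const _)) ((hφ' s hs).1.sub (memLp_const _))
        (hbdry _ _ (hMpos s hs) fun x hx => (hsol.boundary s hs x hx).2.1)
        (hbdry _ _ (hNpos s hs) fun x hx => (hsol.boundary s hs x hx).2.2)
        (hsol.incompressible s hs) ?_ ?_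
      · filter_upwards [hθe s hs] with x hx
        have e : (S s).lap x = (θ s).lap x := rfl
        rw [e]
        -- The extra `Ra` in the vertical derivative turns `Ra w` into part of the transport of `S`.
        simp only [hS, hT, PeriodicW22.shift, Fin.sum_univ_three] at hx ⊢
        simp only [show (0 : Fin 3) ≠ 2 by decide, show (1 : Fin 3) ≠ 2 by decide, if_false,
          if_true, add_zero]
        linear_combination hx
      · filter_upwards [hφe s hs] with x hx
        have e : (T s).lap x = (φ s).lap x := rfl
        rw [e]
        simp only [hS, hT, PeriodicW22.shift]
        have : A * (-(H * γ / A) * (N s - M s)) = -(H * γ) * (N s - M s) := by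
          field_simp
        linear_combination hx - this)
    (by
      simpa using ((hsol.initial_fluid.tendsto_energy hθ₀ hM₀ hθM).const_mul γ).add
        ((hsol.initial_solid.tendsto_energy hφ₀ hN₀ hφN).const_mul A)) ht
  have h1 : ‖Lp.posPart (S t).toL2‖ ^ 2 / 2 ≤ 0 := by
    have h2 : 0 ≤ A * (‖Lp.posPart (T t).toL2‖ ^ 2 / 2) := by positivity
    have h3 : γ * (‖Lp.posPart (S t).toL2‖ ^ 2 / 2) ≤ 0 := by linarith
    exact nonpos_of_mul_nonpos_right h3 hγ
  have h2 : Lp.posPart (S t).toL2 = 0 := by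
    rw [← norm_eq_zero]
    exact pow_eq_zero_iff (two_ne_zero) |>.1 (le_antisymm (by linarith) (sq_nonneg _))
  have h3 := PeriodicW22.le_zero_of_posPart_eq_zero hkx hky h2 hx
  simp only [hS, PeriodicW22.shift] at h3
  linarith

/-- The bound by the initial excesses, from the explicit spatially constant solution. -/
theorem IsPerturbation.fluid_le_of_initial (hkx : 0 < kx) (hky : 0 < ky) (hRa : 0 < Ra)
    (hH : 0 ≤ H) (hA : 0 < A) (hγ : 0 < γ) (hsol : IsPerturbation Ra Da ζ H A γ u p θ φ θ₀ φ₀)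
    (hθ₀ : MemLp θ₀ 2 (cellMeasure kx ky)) (hφ₀ : MemLp φ₀ 2 (cellMeasure kx ky))
    {M₀ N₀ : ℝ} (hM₀ : 0 < M₀) (hN₀ : 0 < N₀)
    (hθM : ∀ᵐ x ∂(cellMeasure kx ky), θ₀ x + (Ra * x 2 - Ra) ≤ M₀)
    (hφN : ∀ᵐ x ∂(cellMeasure kx ky), φ₀ x + (Ra * x 2 - Ra) ≤ N₀)
    {t : ℝ} (ht : 0 < t) {x : Space} (hx : x ∈ cell kx ky) :
    ∃ s ∈ Set.Icc 0 (A / (γ + A)),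
      (θ t).val x + (Ra * x 2 - Ra) ≤ (1 - s) * M₀ + s * N₀ := by
  have hAγ : 0 < γ + A := by positivity
  -- The difference `N - M` decays at rate `k`, while `γ M + A N` is conserved; this fixes the
  -- fractions `a` and `b` below.
  set k : ℝ := H * (γ + A) / A with hk
  have hk0 : 0 ≤ k := by positivity
  set σ : ℝ → ℝ := fun t => 1 - Real.exp (-(k * t)) with hσ
  have hσd : ∀ t, HasDerivAt σ (k * Real.exp (-(k * t))) t := fun t => by
    have h1 : HasDerivAt (fun t => -(k * t)) (-k) t := by
      simpa using! ((hasDerivAt_id t).const_mul k).neg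
    refine (h1.exp.const_sub 1).congr_deriv ?_
    ring
  have hσ0 : ∀ t > 0, 0 ≤ σ t ∧ σ t ≤ 1 := fun t ht =>
    ⟨sub_nonneg.2 (Real.exp_le_one_iff.2 (by nlinarith [mul_nonneg hk0 ht.le])),
      by linarith [Real.exp_pos (-(k * t))]⟩
  set a : ℝ := A / (γ + A) with ha
  set b : ℝ := γ / (γ + A) with hb
  have hab : a + b = 1 := by rw [ha, hb]; field_simp; ring
  have ha0 : 0 < a := by positivity
  have hb0 : 0 < b := by positivity
  have hak : a * k = H := by rw [ha, hk]; field_simp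
  have hbk : b * k = H * γ / A := by rw [hb, hk]; field_simp
  set M : ℝ → ℝ := fun t => M₀ + a * (N₀ - M₀) * σ t with hM
  set N : ℝ → ℝ := fun t => N₀ - b * (N₀ - M₀) * σ t with hN
  have hNM : ∀ t, N t - M t = (N₀ - M₀) * Real.exp (-(k * t)) := fun t => by
    simp only [hM, hN, hσ]
    linear_combination (-(N₀ - M₀) * (1 - Real.exp (-(k * t)))) * hab
  have hMd : ∀ t, HasDerivAt M (H * (N t - M t)) t := fun t => by
    refine (((hσd t).const_mul _).const_add M₀).congr_deriv ?_
    rw [hNM, ← hak]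
    ring
  have hNd : ∀ t, HasDerivAt N (-(H * γ / A) * (N t - M t)) t := fun t => by
    refine (((hσd t).const_mul _).const_sub N₀).congr_deriv ?_
    rw [hNM, ← hbk]
    ring
  have hMe : ∀ t, M t = (1 - a * σ t) * M₀ + a * σ t * N₀ := fun t => by
    simp only [hM]; ring
  have hNe : ∀ t, N t = (1 - b * σ t) * N₀ + b * σ t * M₀ := fun t => by
    simp only [hN]; ring
  have hpos : ∀ {c d q : ℝ}, 0 < c → 0 < d → 0 ≤ q → q < 1 → 0 < (1 - q) * c + q * d :=
    fun hc hd h0 h1 => add_pos_of_pos_of_nonneg (mul_pos (sub_pos.2 h1) hc) (mul_nonneg h0 hd.le)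
  have ha1 : a < 1 := by linarith
  have hb1 : b < 1 := by linarith
  have hσ00 : σ 0 = 0 := by simp [hσ]
  have hM0 : Tendsto M (𝓝[>] 0) (𝓝 M₀) := by
    have := (hMd 0).continuousAt.tendsto.mono_left (nhdsWithin_le_nhds (s := Set.Ioi 0))
    simpa [hM, hσ00] using this
  have hN0 : Tendsto N (𝓝[>] 0) (𝓝 N₀) := by
    have := (hNd 0).continuousAt.tendsto.mono_left (nhdsWithin_le_nhds (s := Set.Ioi 0))
    simpa [hN, hσ00] using this
  refine ⟨a * σ t, ⟨mul_nonneg ha0.le (hσ0 t ht).1, mul_le_of_le_one_right ha0.le (hσ0 t ht).2⟩,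
    ?_⟩
  rw [← hMe]
  refine hsol.fluid_le hkx hky hRa hH hA hγ hθ₀ hφ₀ (fun t _ => hMd t) (fun t _ => hNd t) ?_ ?_
    hM0 hN0 hθM hφN ht hx
  · intro s hs
    rw [hMe]
    exact hpos hM₀ hN₀ (mul_nonneg ha0.le (hσ0 s hs).1)
      ((mul_le_of_le_one_right ha0.le (hσ0 s hs).2).trans_lt ha1)
  · intro s hs
    rw [hNe]
    exact hpos hN₀ hM₀ (mul_nonneg hb0.le (hσ0 s hs).1)
      ((mul_le_of_le_one_right hb0.le (hσ0 s hs).2).trans_lt hb1)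

end Comparison

/-! ### The essential suprema of the initial excesses. -/

section Excess

variable {kx ky Ra : ℝ} {g : Space → ℝ}

theorem cellMeasure_ne_zero (hkx : 0 < kx) (hky : 0 < ky) : cellMeasure kx ky ≠ 0 := by
  have hne : (interior (cell kx ky)).Nonempty := by
    have h0 : (0 : Space) ∈ cell kx ky := by
      rw [cell_eq_Icc]
      refine ⟨le_rfl, fun i => ?_⟩
      fin_cases i <;> simp <;> positivity
    exact closure_nonempty_iff.1 ⟨0, closure_interior_cell hkx hky h0⟩
  rw [cellMeasure, Ne, Measure.restrict_eq_zero]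
  exact (Measure.measure_pos_of_nonempty_interior _ hne).ne'

theorem ae_le_excess (hg : MemLp g ∞ (cellMeasure kx ky)) :
    ∀ᵐ x ∂(cellMeasure kx ky), max (g x + Tb Ra (x 2) - Ra) 0 ≤ excess kx ky Ra g := by
  refine ae_le_essSup ?_
  have hc : ContinuousOn (fun x : Space => Tb Ra (x 2) - Ra) (cell kx ky) := by
    unfold Tb; fun_prop
  obtain ⟨C, hC⟩ := (isCompact_cell kx ky).exists_bound_of_continuousOn hc
  -- A real essential supremum bounds the function only when an essential upper bound exists; the
  -- `L∞` norm and the compactness of the cell provide one.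
  refine isBoundedUnder_of_eventually_le
    (a := max ((eLpNormEssSup g (cellMeasure kx ky)).toReal + C) 0) ?_
  have hfin : eLpNormEssSup g (cellMeasure kx ky) ≠ ⊤ := by
    have := hg.2.ne
    rwa [eLpNorm_exponent_top] at this
  filter_upwards [enorm_ae_le_eLpNormEssSup g (cellMeasure kx ky),
    ae_restrict_mem (measurableSet_cell kx ky)] with x hx hxc
  refine max_le_max_right 0 ?_
  have h1 : |g x| ≤ (eLpNormEssSup g (cellMeasure kx ky)).toReal := by
    have := ENNReal.toReal_mono hfin hx
    simpa using this
  have h2 := hC x hxc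
  rw [Real.norm_eq_abs] at h2
  linarith [le_abs_self (g x), le_abs_self (Tb Ra (x 2) - Ra)]

theorem excess_nonneg (hkx : 0 < kx) (hky : 0 < ky) (hg : MemLp g ∞ (cellMeasure kx ky)) :
    0 ≤ excess kx ky Ra g := by
  have : (ae (cellMeasure kx ky)).NeBot := ae_neBot.2 (cellMeasure_ne_zero hkx hky)
  obtain ⟨x, hx⟩ := (ae_le_excess (Ra := Ra) hg).exists
  exact (le_max_right _ _).trans hx

end Excess

end Penetrative

/-! ### The bound by `Γ`. -/

theorem mainTheorem3 (kx ky Ra Da ζ H A γ : ℝ) (hkx : 0 < kx) (hky : 0 < ky) (hRa : 0 < Ra)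
    (hH : 0 ≤ H) (hA : 0 < A) (hγ : 0 < γ)
    (u : ℝ → Fin 3 → Penetrative.PeriodicW22 kx ky)
    (p θ φ : ℝ → Penetrative.PeriodicW22 kx ky) (θ₀ φ₀ : Space → ℝ)
    (hsol : Penetrative.IsPerturbation Ra Da ζ H A γ u p θ φ θ₀ φ₀)
    (hθ₀ : Penetrative.MemW22 (interior (Penetrative.cell kx ky)) θ₀)
    (hθ₀' : MemLp θ₀ ∞ (Penetrative.cellMeasure kx ky))
    (hφ₀ : Penetrative.MemW22 (interior (Penetrative.cell kx ky)) φ₀)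
    (hφ₀' : MemLp φ₀ ∞ (Penetrative.cellMeasure kx ky)) :
    ∀ c ∈ ({1, A / γ} : Set ℝ),
      0 ≤ Penetrative.Gam kx ky Ra c θ₀ φ₀ ∧
      (∀ᵐ x ∂(Penetrative.cellMeasure kx ky),
        θ₀ x + Penetrative.Tb Ra (x 2) - Ra ≤ Penetrative.Gam kx ky Ra c θ₀ φ₀) ∧
      ∀ t > 0, ∀ x ∈ Penetrative.cell kx ky,
        (θ t).val x + Penetrative.Tb Ra (x 2) - Ra ≤ Penetrative.Gam kx ky Ra c θ₀ φ₀ := by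
  intro c hc
  have hc0 : 0 < c := by
    rcases hc with rfl | rfl
    · exact one_pos
    · positivity
  have hcA : ∀ s ∈ Set.Icc 0 (A / (γ + A)), s ≤ c := by
    intro s hs
    have h1 : A / (γ + A) ≤ 1 := (div_le_one (by positivity)).2 (by linarith)
    have h2 : A / (γ + A) ≤ A / γ := div_le_div_of_nonneg_left hA.le hγ (by linarith)
    rcases hc with rfl | rfl
    · exact hs.2.trans h1
    · exact hs.2.trans h2
  have hEθ := Penetrative.excess_nonneg (Ra := Ra) hkx hky hθ₀'
  have hEφ := Penetrative.excess_nonneg (Ra := Ra) hkx hky hφ₀'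
  have hΓ : Penetrative.excess kx ky Ra θ₀ ≤ Penetrative.Gam kx ky Ra c θ₀ φ₀ := by
    unfold Penetrative.Gam
    split_ifs
    · exact le_rfl
    · exact le_add_of_nonneg_right (mul_nonneg hc0.le hEφ)
  have haeθ : ∀ᵐ x ∂(Penetrative.cellMeasure kx ky),
      θ₀ x + Penetrative.Tb Ra (x 2) - Ra ≤ Penetrative.excess kx ky Ra θ₀ :=
    (Penetrative.ae_le_excess hθ₀').mono fun x hx => (le_max_left _ _).trans hx
  -- The two cases of `Γ` correspond to the starting levels `N₀ = 0` and `N₀ = ess sup (φ₀ + T_b -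
  -- Ra)₊` for the solid.
  obtain ⟨N₀, hN₀, hφN, hΓN⟩ : ∃ N₀, 0 ≤ N₀ ∧
      (∀ᵐ x ∂(Penetrative.cellMeasure kx ky), φ₀ x + (Ra * x 2 - Ra) ≤ N₀) ∧
      Penetrative.excess kx ky Ra θ₀ + c * N₀ ≤ Penetrative.Gam kx ky Ra c θ₀ φ₀ := by
    unfold Penetrative.Gam
    split_ifs with h
    · refine ⟨0, le_rfl, h.mono fun x hx => ?_, by simp⟩
      unfold Penetrative.Tb at hx
      linarith
    · refine ⟨Penetrative.excess kx ky Ra φ₀, hEφ, ?_, le_rfl⟩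
      refine (Penetrative.ae_le_excess (Ra := Ra) hφ₀').mono fun x hx => ?_
      have := (le_max_left _ _).trans hx
      unfold Penetrative.Tb at this
      linarith
  refine ⟨hEθ.trans hΓ, haeθ.mono fun x hx => hx.trans hΓ, fun t ht x hx => ?_⟩
  -- Raising both levels by `ε` makes them strictly positive; since the coefficients `1 - s` and `s`
  -- add up to one, the bound rises by exactly `ε`.
  refine le_of_forall_pos_le_add fun ε hε => ?_
  obtain ⟨s, hs, hle⟩ := hsol.fluid_le_of_initial hkx hky hRa hH hA hγ
    (hθ₀'.mono_exponent le_top) (hφ₀'.mono_exponent le_top)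
    (M₀ := Penetrative.excess kx ky Ra θ₀ + ε) (N₀ := N₀ + ε) (by linarith) (by linarith)
    (by
      filter_upwards [haeθ] with y hy
      unfold Penetrative.Tb at hy
      linarith)
    (by filter_upwards [hφN] with y hy using by linarith) ht hx
  have h1 : s * N₀ ≤ c * N₀ := mul_le_mul_of_nonneg_right (hcA s hs) hN₀
  have h2 : 0 ≤ s * Penetrative.excess kx ky Ra θ₀ := mul_nonneg hs.1 hEθ
  unfold Penetrative.Tb
  linarith
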